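/- For $0<s<1$ and measurable $u:\mathbb{R}^2\to\mathbb{R}$ put \[ [u]_{W^{s,2}(\mathbb{R}^2)}=\left(\iint_{\mathbb{R}^2\times\mathbb{R}^2}\frac{|u(x)-u(y)|^2}{|x-y|^{2+2s}}\,dx\,dy\right)^{1/2}, \] and let $W^{s,2}(\mathbb{R}^2)=\{u\in L^2(\mathbb{R}^2):[u]_{W^{s,2}(\mathbb{R}^2)}<+\infty\}$, with the norm $\|u\|_{L^2(\mathbb{R}^2)}+[u]_{W^{s,2}(\mathbb{R}^2)}$. For an open set $\Omega\subset\mathbb{R}^2$, let $\widetilde W^{s,2}_0(\Omega)$ be the closure of $C^\infty_0(\Omega)$ in $W^{s,2}(\mathbb{R}^2)$ (functions being extended by zero), let $\mathcal{D}^{s,2}_0(\Omega)$ be the completion of $C^\infty_0(\Omega)$ with respect to the norm $u\mapsto[u]_{W^{s,2}(\mathbb{R}^2)}$, and let $r_\Omega=\sup\{\rho>0:\exists\,x\in\Omega,\ B_\rho(x)\subset\Omega\}$ be the inradius of $\Omega$. 1. Let $1/2<s<1$ and let $\Omega\subset\mathbb{R}^2$ be an open simply connected (in particular non-empty and connected)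 set with $r_\Omega<+\infty$. Then $\mathcal{D}^{s,2}_0(\Omega)=\widetilde W^{s,2}_0(\Omega)$, that is, there is a linear homeomorphism of $\mathcal{D}^{s,2}_0(\Omega)$ onto $\widetilde W^{s,2}_0(\Omega)$ that is the identity on $C^\infty_0(\Omega)$. 2. Let $0<s\le 1/2$ and let $\Theta=\mathbb{R}^2\setminus\bigcup_{i\in\mathbb{Z}}\{(x,i):|x|\ge 1\}$ be the infinite complement comb. Then $\mathcal{D}^{s,2}_0(\Theta)$ and $\widetilde W^{s,2}_0(\Theta)$ cannot be identified with each other: there is no linear bijection of $\mathcal{D}^{s,2}_0(\Theta)$ onto $\widetilde W^{s,2}_0(\Theta)$ that is the identity on $C^\infty_0(\Theta)$ and that is continuous or has a continuous inverse. -/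

import Mathlib

open MeasureTheory Set TopologicalSpace
open scoped ENNReal Distributions

/-- The Euclidean plane. -/
abbrev Plane : Type := EuclideanSpace ℝ (Fin 2)

/-! ### The Gagliardo-Slobodeckii seminorm -/

/-- The Gagliardo-Slobodeckii seminorm
`(∬ |u x - u y| ^ 2 / |x - y| ^ (2 + 2 s) dx dy) ^ (1 / 2)` on the plane, with values in `[0, ∞]`. -/
noncomputable def gagliardoENorm (s : ℝ) (u : Plane → ℝ) : ℝ≥0∞ :=
  (∫⁻ p : Plane × Plane,
    ENNReal.ofReal (|u p.1 - u p.2| ^ 2 / ‖p.1 - p.2‖ ^ (2 + 2 * s))) ^ (1 / 2 : ℝ)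

theorem gagliardoENorm_eq_eLpNorm (s : ℝ) (u : Plane → ℝ) :
    gagliardoENorm s u =
      eLpNorm (fun p : Plane × Plane => (u p.1 - u p.2) / ‖p.1 - p.2‖ ^ (1 + s)) 2 volume := by
  rw [eLpNorm_eq_lintegral_rpow_enorm_toReal (by norm_num) (by norm_num), gagliardoENorm]
  simp only [ENNReal.toReal_ofNat]
  congr 1
  refine lintegral_congr fun p => ?_
  rw [Real.enorm_eq_ofReal_abs, ENNReal.ofReal_rpow_of_nonneg (abs_nonneg _) (by norm_num)]
  congr 1
  rw [abs_div, abs_of_nonneg (Real.rpow_nonneg (norm_nonneg (p.1 - p.2)) _),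
    Real.div_rpow (abs_nonneg _) (Real.rpow_nonneg (norm_nonneg _) _), ← Real.rpow_mul
      (norm_nonneg _), Real.rpow_two]
  congr 2
  ring

theorem aestronglyMeasurable_gagliardo (s : ℝ) {u : Plane → ℝ}
    (hu : AEStronglyMeasurable u volume) :
    AEStronglyMeasurable
      (fun p : Plane × Plane => (u p.1 - u p.2) / ‖p.1 - p.2‖ ^ (1 + s)) volume := by
  have h1 : AEStronglyMeasurable (fun p : Plane × Plane => u p.1) volume :=
    hu.comp_quasiMeasurePreserving Measure.quasiMeasurePreserving_fst
  have h2 : AEStronglyMeasurable (fun p : Plane × Plane => u p.2) volume :=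
    hu.comp_quasiMeasurePreserving Measure.quasiMeasurePreserving_snd
  have h3 : Measurable (fun p : Plane × Plane => ‖p.1 - p.2‖ ^ (1 + s)) := by fun_prop
  exact ((h1.sub h2).aemeasurable.div h3.aemeasurable).aestronglyMeasurable

theorem gagliardoENorm_congr (s : ℝ) {u v : Plane → ℝ} (h : u =ᵐ[volume] v) :
    gagliardoENorm s u = gagliardoENorm s v := by
  rw [gagliardoENorm_eq_eLpNorm, gagliardoENorm_eq_eLpNorm]
  apply eLpNorm_congr_ae
  have h1 : ∀ᵐ p : Plane × Plane, u p.1 = v p.1 :=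
    Measure.quasiMeasurePreserving_fst.ae h
  have h2 : ∀ᵐ p : Plane × Plane, u p.2 = v p.2 :=
    Measure.quasiMeasurePreserving_snd.ae h
  filter_upwards [h1, h2] with p hp1 hp2
  rw [hp1, hp2]

theorem gagliardoENorm_zero (s : ℝ) : gagliardoENorm s 0 = 0 := by
  rw [gagliardoENorm_eq_eLpNorm]
  simp

theorem gagliardoENorm_add_le (s : ℝ) {u v : Plane → ℝ}
    (hu : AEStronglyMeasurable u volume) (hv : AEStronglyMeasurable v volume) :
    gagliardoENorm s (u + v) ≤ gagliardoENorm s u + gagliardoENorm s v := by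
  simp only [gagliardoENorm_eq_eLpNorm]
  refine le_trans (le_of_eq ?_) (eLpNorm_add_le (aestronglyMeasurable_gagliardo s hu)
    (aestronglyMeasurable_gagliardo s hv) (by norm_num))
  congr 1
  funext p
  simp only [Pi.add_apply]
  ring

theorem gagliardoENorm_smul (s c : ℝ) (u : Plane → ℝ) :
    gagliardoENorm s (c • u) = ‖c‖ₑ * gagliardoENorm s u := by
  simp only [gagliardoENorm_eq_eLpNorm]
  rw [← eLpNorm_const_smul]
  congr 1
  funext p
  simp only [Pi.smul_apply, smul_eq_mul]
  ring

/-- Smooth compactly supported functions have finite seminorm for `0 < s < 1`. -/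
theorem gagliardoENorm_testFunction_lt_top (s : Ioo (0 : ℝ) 1) {Ω : Opens Plane}
    (u : 𝓓(Ω, ℝ)) : gagliardoENorm s u < ∞ := by
  obtain ⟨s, hs0, hs1⟩ := s
  obtain ⟨L, hL⟩ := (u.contDiff.of_le (m := 1) (by exact_mod_cast le_top)
    ).lipschitzWith_of_hasCompactSupport u.hasCompactSupport (by norm_num)
  obtain ⟨M, hM⟩ := u.continuous.bounded_above_of_compact_support u.hasCompactSupport
  set K : Set Plane := tsupport u with hK
  have hKc : IsCompact K := u.hasCompactSupport
  have hKm : MeasurableSet K := hKc.isClosed.measurableSet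
  set f : ℝ → ℝ := fun r => min ((L : ℝ) ^ 2 * r ^ 2) (4 * M ^ 2) / r ^ (2 + 2 * s) with hf
  have hfm : Measurable f := by
    rw [hf]; fun_prop
  set g : Plane → ℝ≥0∞ := fun h => ENNReal.ofReal (f ‖h‖) with hg
  have hgm : Measurable g := by
    rw [hg]; fun_prop
  have hint : Integrable (fun h : Plane => f ‖h‖) volume := by
    rw [integrable_fun_norm_addHaar]
    have hdim : Module.finrank ℝ Plane - 1 = 1 := by simp
    rw [hdim, ← Ioc_union_Ioi_eq_Ioi (zero_le_one (α := ℝ))]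
    refine IntegrableOn.union ?_ ?_
    · have h1 : IntegrableOn (fun r : ℝ => (L : ℝ) ^ 2 * r ^ (1 - 2 * s)) (Ioc 0 1) := by
        have := (intervalIntegral.intervalIntegrable_rpow' (a := 0) (b := 1)
          (r := 1 - 2 * s) (by linarith))
        rw [intervalIntegrable_iff_integrableOn_Ioc_of_le zero_le_one] at this
        exact this.const_mul _
      refine Integrable.mono' h1 (by fun_prop) ?_
      filter_upwards [ae_restrict_mem measurableSet_Ioc] with r hr
      have hr0 : 0 < r := hr.1
      have hfr : 0 ≤ f r := by rw [hf]; positivity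
      rw [Real.norm_of_nonneg (by rw [smul_eq_mul]; positivity), smul_eq_mul, hf]
      have e : (L : ℝ) ^ 2 * r ^ (1 - 2 * s) =
          r ^ 1 * (((L : ℝ) ^ 2 * r ^ 2) / r ^ (2 + 2 * s)) := by
        rw [show 1 - 2 * s = 3 - (2 + 2 * s) by ring, Real.rpow_sub hr0]
        rw [show (3 : ℝ) = ((3 : ℕ) : ℝ) by norm_num, Real.rpow_natCast]
        ring
      rw [e]
      exact mul_le_mul_of_nonneg_left (div_le_div_of_nonneg_right (min_le_left _ _)
        (by positivity)) (by positivity)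
    · have h1 : IntegrableOn (fun r : ℝ => 4 * M ^ 2 * r ^ (-1 - 2 * s)) (Ioi 1) :=
        (integrableOn_Ioi_rpow_of_lt (by linarith) one_pos).const_mul _
      refine Integrable.mono' h1 (by fun_prop) ?_
      filter_upwards [ae_restrict_mem measurableSet_Ioi] with r hr
      have hr0 : 0 < r := lt_trans one_pos hr
      have hfr : 0 ≤ f r := by rw [hf]; positivity
      rw [Real.norm_of_nonneg (by rw [smul_eq_mul]; positivity), smul_eq_mul, hf]
      have e : 4 * M ^ 2 * r ^ (-1 - 2 * s) =
          r ^ 1 * ((4 * M ^ 2) / r ^ (2 + 2 * s)) := by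
        rw [show -1 - 2 * s = 1 - (2 + 2 * s) by ring, Real.rpow_sub hr0, Real.rpow_one]
        ring
      rw [e]
      exact mul_le_mul_of_nonneg_left (div_le_div_of_nonneg_right (min_le_right _ _)
        (by positivity)) (by positivity)
  have hgfin : ∫⁻ h, g h < ∞ := hint.lintegral_lt_top
  rw [gagliardoENorm]
  refine ENNReal.rpow_lt_top_of_nonneg (by norm_num) (ne_of_lt ?_)
  calc ∫⁻ p : Plane × Plane,
        ENNReal.ofReal (|u p.1 - u p.2| ^ 2 / ‖p.1 - p.2‖ ^ (2 + 2 * s))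
      ≤ ∫⁻ p : Plane × Plane, (K.indicator 1 p.1 * g (p.1 - p.2)
          + K.indicator 1 p.2 * g (p.1 - p.2)) := by
        refine lintegral_mono fun p => ?_
        have hb : ENNReal.ofReal (|u p.1 - u p.2| ^ 2 / ‖p.1 - p.2‖ ^ (2 + 2 * s))
            ≤ g (p.1 - p.2) := by
          rw [hg, hf]
          refine ENNReal.ofReal_le_ofReal ?_
          refine div_le_div_of_nonneg_right (le_min ?_ ?_) (by positivity)
          · have := hL.dist_le_mul p.1 p.2
            rw [Real.dist_eq, dist_eq_norm] at this
            rw [← mul_pow]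
            gcongr
          · have a1 := hM p.1
            have a2 := hM p.2
            rw [Real.norm_eq_abs] at a1 a2
            have : |u p.1 - u p.2| ≤ 2 * M := by
              have := abs_sub (u p.1) (u p.2)
              linarith
            calc |u p.1 - u p.2| ^ 2 ≤ (2 * M) ^ 2 := by gcongr
              _ = 4 * M ^ 2 := by ring
        by_cases h1 : p.1 ∈ K
        · rw [indicator_of_mem h1]
          simpa using le_add_right hb
        by_cases h2 : p.2 ∈ K
        · rw [indicator_of_mem h2]
          simpa using le_add_left hb
        · simp [image_eq_zero_of_notMem_tsupport h1, image_eq_zero_of_notMem_tsupport h2]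
    _ = (∫⁻ p : Plane × Plane, K.indicator 1 p.1 * g (p.1 - p.2))
          + ∫⁻ p : Plane × Plane, K.indicator 1 p.2 * g (p.1 - p.2) := by
        refine lintegral_add_left ?_ _
        have : Measurable (K.indicator (1 : Plane → ℝ≥0∞)) := measurable_one.indicator hKm
        fun_prop
    _ = volume K * (∫⁻ h, g h) + volume K * ∫⁻ h, g h := by
        have hi : Measurable (K.indicator (1 : Plane → ℝ≥0∞)) := measurable_one.indicator hKm
        congr 1
        · rw [Measure.volume_eq_prod, lintegral_prod _ (by fun_prop)]
          simp only
          have : ∀ x : Plane, ∫⁻ y, K.indicator 1 x * g (x - y) =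
              K.indicator 1 x * ∫⁻ h, g h := fun x => by
            rw [lintegral_const_mul _ (by fun_prop), lintegral_sub_left_eq_self]
          simp_rw [this]
          rw [lintegral_mul_const _ hi, lintegral_indicator_one hKm]
        · rw [Measure.volume_eq_prod, lintegral_prod_symm _ (by fun_prop)]
          simp only
          have : ∀ y : Plane, ∫⁻ x, K.indicator 1 y * g (x - y) =
              K.indicator 1 y * ∫⁻ h, g h := fun y => by
            rw [lintegral_const_mul _ (by fun_prop), lintegral_sub_right_eq_self]
          simp_rw [this]
          rw [lintegral_mul_const _ hi, lintegral_indicator_one hKm]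
    _ < ∞ := by
        have := ENNReal.mul_lt_top (hKc.measure_lt_top (μ := volume)) hgfin
        rw [ENNReal.add_lt_top]
        exact ⟨this, this⟩

/-! ### The homogeneous space -/

/-- The vector space `C_c^∞(Ω)`, to be endowed with the Gagliardo-Slobodeckii seminorm (and not
with the usual topology of test functions). -/
def HomogeneousTest (_s : Ioo (0 : ℝ) 1) (Ω : Opens Plane) : Type := 𝓓(Ω, ℝ)

namespace HomogeneousTest

variable {s : Ioo (0 : ℝ) 1} {Ω : Opens Plane}

/-- A test function, regarded as an element of `HomogeneousTest`. -/
def of (s : Ioo (0 : ℝ) 1) (u : 𝓓(Ω, ℝ)) : HomogeneousTest s Ω := u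

/-- The test function underlying an element of `HomogeneousTest`. -/
def toTestFunction (u : HomogeneousTest s Ω) : 𝓓(Ω, ℝ) := u

noncomputable instance : AddCommGroup (HomogeneousTest s Ω) := inferInstanceAs (AddCommGroup 𝓓(Ω, ℝ))

noncomputable instance : Module ℝ (HomogeneousTest s Ω) := inferInstanceAs (Module ℝ 𝓓(Ω, ℝ))

/-- The norm `[u]` on `C_c^∞(Ω)`. -/
noncomputable def gagliardoSeminorm (s : Ioo (0 : ℝ) 1) (Ω : Opens Plane) :
    Seminorm ℝ (HomogeneousTest s Ω) :=
  Seminorm.of (fun u => (gagliardoENorm s u.toTestFunction).toReal)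
    (fun u v => by
      have hu := gagliardoENorm_testFunction_lt_top s u.toTestFunction
      have hv := gagliardoENorm_testFunction_lt_top s v.toTestFunction
      rw [← ENNReal.toReal_add hu.ne hv.ne]
      exact ENNReal.toReal_mono (ENNReal.add_lt_top.2 ⟨hu, hv⟩).ne
        (gagliardoENorm_add_le s u.toTestFunction.continuous.aestronglyMeasurable
          v.toTestFunction.continuous.aestronglyMeasurable))
    (fun c u => by
      have h : gagliardoENorm s (c • u).toTestFunction =
          ‖c‖ₑ * gagliardoENorm s u.toTestFunction :=
        gagliardoENorm_smul s c u.toTestFunction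
      rw [h, ENNReal.toReal_mul, toReal_enorm])

noncomputable instance : SeminormedAddCommGroup (HomogeneousTest s Ω) :=
  (gagliardoSeminorm s Ω).toAddGroupSeminorm.toSeminormedAddCommGroup

theorem norm_def (u : HomogeneousTest s Ω) :
    ‖u‖ = (gagliardoENorm s u.toTestFunction).toReal := rfl

noncomputable instance : NormedSpace ℝ (HomogeneousTest s Ω) where
  norm_smul_le c u := (map_smul_eq_mul (gagliardoSeminorm s Ω) c u).le

end HomogeneousTest

/-- The homogeneous space `𝒟₀^{s,2}(Ω)`: the completion of `C_c^∞(Ω)` with respect to the norm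
`u ↦ [u]`. -/
abbrev HomogeneousSobolev (s : Ioo (0 : ℝ) 1) (Ω : Opens Plane) : Type :=
  UniformSpace.Completion (HomogeneousTest s Ω)

/-- The canonical map of `C_c^∞(Ω)` into its completion `𝒟₀^{s,2}(Ω)`. -/
noncomputable def testToHomogeneous (s : Ioo (0 : ℝ) 1) {Ω : Opens Plane} (u : 𝓓(Ω, ℝ)) :
    HomogeneousSobolev s Ω :=
  (HomogeneousTest.of s u : UniformSpace.Completion (HomogeneousTest s Ω))

/-! ### The spaces `W^{s,2}(ℝ²)` and `W̃₀^{s,2}(Ω)` -/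

/-- The (classes of) functions `u ∈ L²(ℝ²)` with `[u] < ∞`, as a linear subspace of `L²(ℝ²)`. -/
noncomputable def fracSobolevSubmodule (s : Ioo (0 : ℝ) 1) :
    Submodule ℝ (Lp ℝ 2 (volume : Measure Plane)) where
  carrier := {u | gagliardoENorm s u < ∞}
  add_mem' {u v} hu hv := by
    rw [mem_ofPred_eq] at *
    rw [gagliardoENorm_congr s (Lp.coeFn_add u v)]
    exact (gagliardoENorm_add_le s (Lp.aestronglyMeasurable u)
      (Lp.aestronglyMeasurable v)).trans_lt (ENNReal.add_lt_top.2 ⟨hu, hv⟩)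
  zero_mem' := by
    rw [mem_ofPred_eq, gagliardoENorm_congr s (Lp.coeFn_zero ℝ 2 volume), gagliardoENorm_zero]
    exact ENNReal.zero_lt_top
  smul_mem' c u hu := by
    rw [mem_ofPred_eq] at *
    rw [gagliardoENorm_congr s (Lp.coeFn_smul c u), gagliardoENorm_smul]
    exact ENNReal.mul_lt_top enorm_lt_top hu

/-- The fractional Sobolev space `W^{s,2}(ℝ²)`, which carries the norm `‖u‖_{L²} + [u]` (and not
the norm of `L²`). -/
def FracSobolev (s : Ioo (0 : ℝ) 1) : Type := fracSobolevSubmodule s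

namespace FracSobolev

variable {s : Ioo (0 : ℝ) 1}

/-- The class in `L²(ℝ²)` underlying an element of `W^{s,2}(ℝ²)`. -/
def toLp (u : FracSobolev s) : Lp ℝ 2 (volume : Measure Plane) := u.1

noncomputable instance : AddCommGroup (FracSobolev s) :=
  inferInstanceAs (AddCommGroup (fracSobolevSubmodule s))

noncomputable instance : Module ℝ (FracSobolev s) :=
  inferInstanceAs (Module ℝ (fracSobolevSubmodule s))

/-- The norm `‖u‖_{L²} + [u]`. -/
noncomputable instance : Norm (FracSobolev s) where
  norm u := ‖u.toLp‖ + (gagliardoENorm s u.toLp).toReal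

theorem norm_def (u : FracSobolev s) :
    ‖u‖ = ‖u.toLp‖ + (gagliardoENorm s u.toLp).toReal := rfl

theorem normedSpace_core : NormedSpace.Core ℝ (FracSobolev s) where
  norm_nonneg u := add_nonneg (norm_nonneg _) ENNReal.toReal_nonneg
  norm_smul c u := by
    have h1 : (c • u).toLp = c • u.toLp := rfl
    rw [norm_def, norm_def, h1, gagliardoENorm_congr s (Lp.coeFn_smul c u.toLp),
      gagliardoENorm_smul, ENNReal.toReal_mul, toReal_enorm, norm_smul, mul_add]
  norm_triangle u v := by
    have h1 : (u + v).toLp = u.toLp + v.toLp := rfl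
    have hu : gagliardoENorm s u.toLp < ∞ := u.2
    have hv : gagliardoENorm s v.toLp < ∞ := v.2
    have h2 : (gagliardoENorm s (u.toLp + v.toLp : Lp ℝ 2 (volume : Measure Plane))).toReal ≤
        (gagliardoENorm s u.toLp).toReal + (gagliardoENorm s v.toLp).toReal := by
      rw [gagliardoENorm_congr s (Lp.coeFn_add u.toLp v.toLp),
        ← ENNReal.toReal_add hu.ne hv.ne]
      exact ENNReal.toReal_mono (ENNReal.add_lt_top.2 ⟨hu, hv⟩).ne
        (gagliardoENorm_add_le s (Lp.aestronglyMeasurable _) (Lp.aestronglyMeasurable _))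
    rw [norm_def, norm_def, norm_def, h1]
    linarith [norm_add_le u.toLp v.toLp]
  norm_eq_zero_iff u := by
    constructor
    · intro h
      have h1 : 0 ≤ ‖u.toLp‖ := norm_nonneg _
      have h2 : 0 ≤ (gagliardoENorm s u.toLp).toReal := ENNReal.toReal_nonneg
      rw [norm_def] at h
      have h3 : u.toLp = 0 := norm_eq_zero.1 (by linarith)
      exact Subtype.ext h3
    · rintro rfl
      have h1 : (0 : FracSobolev s).toLp = 0 := rfl
      rw [norm_def, h1, gagliardoENorm_congr s (Lp.coeFn_zero ℝ 2 volume), gagliardoENorm_zero]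
      simp

noncomputable instance : NormedAddCommGroup (FracSobolev s) :=
  NormedAddCommGroup.ofCore normedSpace_core

noncomputable instance : NormedSpace ℝ (FracSobolev s) :=
  NormedSpace.ofCore normedSpace_core

end FracSobolev

theorem memLp_testFunction {Ω : Opens Plane} (u : 𝓓(Ω, ℝ)) :
    MemLp u 2 (volume : Measure Plane) :=
  u.continuous.memLp_of_hasCompactSupport u.hasCompactSupport

/-- A test function (extended by zero outside `Ω`), regarded as an element of `W^{s,2}(ℝ²)`. -/
noncomputable def testToFracSobolev (s : Ioo (0 : ℝ) 1) (Ω : Opens Plane) :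
    𝓓(Ω, ℝ) →ₗ[ℝ] FracSobolev s where
  toFun u := ⟨(memLp_testFunction u).toLp u, by
    have h : gagliardoENorm s ((memLp_testFunction u).toLp u) = gagliardoENorm s u :=
      gagliardoENorm_congr s (memLp_testFunction u).coeFn_toLp
    exact h.trans_lt (gagliardoENorm_testFunction_lt_top s u)⟩
  map_add' _ _ := rfl
  map_smul' _ _ := rfl

/-- The space `W̃₀^{s,2}(Ω)`: the closure of `C_c^∞(Ω)` in `W^{s,2}(ℝ²)`, with the norm of
`W^{s,2}(ℝ²)`. -/
noncomputable def fracSobolevZero (s : Ioo (0 : ℝ) 1) (Ω : Opens Plane) :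
    Submodule ℝ (FracSobolev s) :=
  (LinearMap.range (testToFracSobolev s Ω)).topologicalClosure

/-- The inclusion of `C_c^∞(Ω)` into `W̃₀^{s,2}(Ω)`. -/
noncomputable def testToFracSobolevZero (s : Ioo (0 : ℝ) 1) {Ω : Opens Plane} (u : 𝓓(Ω, ℝ)) :
    fracSobolevZero s Ω :=
  ⟨testToFracSobolev s Ω u,
    Submodule.le_topologicalClosure _ (LinearMap.mem_range_self _ u)⟩

/-! ### Inradius and the infinite complement comb -/

/-- The inradius of a set `Ω`: the supremum in `[0, ∞]` of the radii `ρ > 0` of the open disks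
`B_ρ(x) ⊆ Ω` with `x ∈ Ω`. -/
noncomputable def inradius (Ω : Set Plane) : ℝ≥0∞ :=
  ⨆ (ρ : ℝ) (_ : 0 < ρ ∧ ∃ x ∈ Ω, Metric.ball x ρ ⊆ Ω), ENNReal.ofReal ρ

/-- The teeth of the comb: the union over `i ∈ ℤ` of the sets `{(x, i) : |x| ≥ 1}`. -/
def combTeeth : Set Plane := ⋃ i : ℤ, {x : Plane | 1 ≤ |x 0| ∧ x 1 = i}

theorem isClosed_combTeeth : IsClosed combTeeth := by
  have h : combTeeth = {x : Plane | 1 ≤ |x 0|} ∩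
      (fun x : Plane => x 1) ⁻¹' (range ((↑) : ℤ → ℝ)) := by
    ext x
    simp only [combTeeth, mem_iUnion, mem_ofPred_eq, mem_inter_iff, mem_preimage, mem_range]
    exact ⟨fun ⟨i, h1, h2⟩ => ⟨h1, i, h2.symm⟩, fun ⟨h1, i, h2⟩ => ⟨i, h1, h2.symm⟩⟩
  rw [h]
  refine IsClosed.inter (isClosed_le (by fun_prop) (by fun_prop)) ?_
  exact Int.isClosedEmbedding_coe_real.isClosed_range.preimage (by fun_prop)

/-- The infinite complement comb `Θ`: the open set of all points of the plane outside the teeth. -/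
def infiniteComplementComb : Opens Plane := ⟨combTeethᶜ, isClosed_combTeeth.isOpen_compl⟩

/-!
Both parts reduce to the Poincaré inequality `‖u‖_{L²} ≤ C [u]` for `u ∈ C_c^∞(Ω)`. If it holds, the
two norms are equivalent on `C_c^∞(Ω)`, and the identity of `C_c^∞(Ω)` extends to an isomorphism of
the completions (`exists_equiv_of_poincare`). Conversely, since `W^{s,2}(ℝ²)` is complete, a linear
bijection that is continuous in one direction is continuous in both by the open mapping theorem, and
its bound gives back the inequality (`exists_poincare_of_equiv`).

*The inequality for `s > 1 / 2`.* In a simply connected domain, no rectangle around a point `z` of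
the complement has its boundary in the domain: the boundary would be a loop along which `p - z` has
no continuous logarithm (`exists_notMem_boundary_rectangle`). Hence, for one of the two coordinate
directions, all lines of that direction on one side of `z` and close to it meet the complement near
`z` (`exists_side_forall_exists_notMem`). As the inradius is finite, there is such a `z` in each
square of a sufficiently large grid, and in this square `u` vanishes somewhere on each of a family
of parallel lines of positive measure. Comparing the mean of `u²` over dyadic squares that shrink to
such a zero costs the energy of these squares (`cellMeanSq_le`), which is bounded by that of the
columns containing them. The integral over the lines of the energy of columns of width `h` is `h`
times the whole energy (`lintegral_columnEnergy`), and this turns the losses into the terms of a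
geometric series, convergent exactly because `s > 1 / 2` (`tsum_dyadic_ne_top`). So the inequality
holds in each square (`volume_mul_cellMeanSq_le`), and the squares are summed up
(`exists_lintegral_sq_le`).

*Its failure in the comb for `s ≤ 1 / 2`.* The energy of a cutoff function of the `ε`-neighbourhood
of a segment is of order `ε ^ (1 - 2 s)` (`exists_lintegral_gagliardoKernel_le`), hence bounded as
`ε → 0`, while the cutoff tends to `0` almost everywhere, and so weakly. By the Hahn-Banach theorem,
here in the form `Vᗮᗮ = closure V`, test functions of the plane are limits of test functions of the
comb, and the inequality would pass to them (`poincare_of_tsupport_sub_subset`). It is false there,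
by scaling (`not_poincare_comb`).
-/

/-! ### Simply connected plane domains and rectangles -/

theorem log_neg_I_mul {w : ℂ} (hre : 0 < w.re) (him : 0 < w.im) :
    Complex.log (-Complex.I * w) = Complex.log w - Real.pi / 2 * Complex.I := by
  have hw : w ≠ 0 := fun h => by simp [h] at hre
  have h1 : 0 ≤ w.arg := Complex.arg_nonneg_iff.2 him.le
  have h2 := Complex.arg_le_pi w
  have h3 := Real.pi_pos
  have h4 : (-Complex.I).arg + w.arg ∈ Ioc (-Real.pi) Real.pi := by
    rw [Complex.arg_neg_I]
    constructor <;> linarith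
  rw [Complex.log_mul_eq_add_log_iff (by simp) hw |>.2 h4, Complex.log_neg_I]
  ring

/-- On a connected set, two continuous logarithms of proportional functions differ by a
constant. -/
theorem IsPreconnected.sub_log_eq {X : Type*} [TopologicalSpace X] {S : Set X}
    (hS : IsPreconnected S) {L g : X → ℂ} (hL : ContinuousOn L S) (hg : ContinuousOn g S)
    (hexp : ∀ p ∈ S, Complex.exp (L p) = g p) {c : ℂ} (hc : ∀ p ∈ S, c * g p ∈ Complex.slitPlane)
    {p q : X} (hp : p ∈ S) (hq : q ∈ S) :
    L p - Complex.log (c * g p) = L q - Complex.log (c * g q) := by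
  set h : X → ℂ := fun p => L p - Complex.log (c * g p) with hh
  have hcont : ContinuousOn h S := hL.sub ((continuousOn_const.mul hg).clog hc)
  have hexp' : ∀ x ∈ S, ∃ n : ℤ, h x = h q + n * (2 * Real.pi * Complex.I) := fun x hx => by
    have key : ∀ y ∈ S, c * Complex.exp (h y) = 1 := fun y hy => by
      have h0 := Complex.slitPlane_ne_zero (hc y hy)
      rw [hh, Complex.exp_sub, Complex.exp_log h0, hexp y hy, ← mul_div_assoc, div_self h0]
    refine Complex.exp_eq_exp_iff_exists_int.1 ?_
    have hc0 : c ≠ 0 := fun h0 => by simpa [h0] using key q hq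
    exact mul_left_cancel₀ hc0 ((key x hx).trans (key q hq).symm)
  have hdisc : DiscreteTopology (range ((↑) : ℤ → ℝ)) :=
    (Int.isClosedEmbedding_coe_real.isEmbedding.toHomeomorph).symm.isEmbedding.discreteTopology
  have hpi : (2 * Real.pi * Complex.I) ≠ 0 := by
    simp [Real.pi_ne_zero]
  have hk := hS.constant_of_mapsTo (T := range ((↑) : ℤ → ℝ))
    (f := fun x => ((h x - h q) / (2 * Real.pi * Complex.I)).re)
    ⟨hdisc⟩ (Complex.continuous_re.comp_continuousOn ((hcont.sub continuousOn_const).div_const _))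
    (fun x hx => by
      obtain ⟨n, hn⟩ := hexp' x hx
      refine ⟨n, ?_⟩
      simp only [hn, add_sub_cancel_left, mul_div_cancel_right₀ _ hpi, Complex.intCast_re])
    hp hq
  obtain ⟨n, hn⟩ := hexp' p hp
  simp only [hn, add_sub_cancel_left, mul_div_cancel_right₀ _ hpi, Complex.intCast_re, sub_self,
    zero_div, Complex.zero_re] at hk
  change h p = h q
  rw [hn, show n = 0 by exact_mod_cast hk]
  simp

theorem isPreconnected_plane_box (a b c d : ℝ) :
    IsPreconnected {p : Plane | p 0 ∈ Icc a b ∧ p 1 ∈ Icc c d} := by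
  refine Convex.isPreconnected ?_
  refine ((convex_Icc a b).is_linear_preimage (f := fun p : Plane => p 0) ⟨?_, ?_⟩).inter
    ((convex_Icc c d).is_linear_preimage (f := fun p : Plane => p 1) ⟨?_, ?_⟩) <;> simp

/-- A simply connected plane domain containing the boundary of a rectangle contains the
rectangle: the boundary winds once around each inner point, so that there is no continuous
logarithm of `p - z` along it. The four sides are tested against the branches of the logarithm on
the four half planes that contain them, consecutive branches being rotated by a quarter turn. -/
theorem exists_notMem_boundary_rectangle {Ω : Opens Plane} (hΩ : IsSimplyConnected (Ω : Set Plane))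
    {z : Plane} (hz : z ∉ Ω) {a b c d : ℝ} (ha : a < z 0) (hb : z 0 < b) (hc : c < z 1)
    (hd : z 1 < d) :
    ∃ p ∉ Ω, (p 0 = a ∨ p 0 = b) ∧ p 1 ∈ Icc c d ∨ (p 1 = c ∨ p 1 = d) ∧ p 0 ∈ Icc a b := by
  by_contra! hcon
  set g : Plane → ℂ := fun p => ⟨p 0 - z 0, p 1 - z 1⟩ with hg
  have hgc : Continuous g := by
    have : g = fun p : Plane => ((p 0 - z 0 : ℝ) : ℂ) + ((p 1 - z 1 : ℝ) : ℂ) * Complex.I := by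
      funext p
      exact (Complex.mk_eq_add_mul_I _ _)
    rw [this]
    fun_prop
  obtain ⟨L, hLc, hL⟩ := Complex.exists_continuousOn_eqOn_exp_comp hΩ Ω.isOpen hgc.continuousOn
    (by
      rintro ⟨p, hp, h0⟩
      have h1 := congrArg Complex.re h0
      have h2 := congrArg Complex.im h0
      simp only [hg, Complex.zero_re, Complex.zero_im] at h1 h2
      apply hz
      convert! hp
      ext i
      fin_cases i
      · simpa using (sub_eq_zero.1 h1).symm
      · simpa using (sub_eq_zero.1 h2).symm)
  have side : ∀ (a' b' c' d' : ℝ) (w : ℂ),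
      (∀ p : Plane, p 0 ∈ Icc a' b' → p 1 ∈ Icc c' d' → p ∈ Ω ∧ 0 < (w * g p).re) →
      ∀ x y x' y' : ℝ, x ∈ Icc a' b' → y ∈ Icc c' d' → x' ∈ Icc a' b' → y' ∈ Icc c' d' →
      L !₂[x, y] - Complex.log (w * g !₂[x, y]) =
        L !₂[x', y'] - Complex.log (w * g !₂[x', y']) := by
    intro a' b' c' d' w h x y x' y' hx hy hx' hy'
    refine (isPreconnected_plane_box a' b' c' d').sub_log_eq
      (hLc.mono fun p hp => (h p hp.1 hp.2).1) hgc.continuousOn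
      (fun p hp => hL (h p hp.1 hp.2).1) (fun p hp => Or.inl (h p hp.1 hp.2).2) ?_ ?_
    · simpa using ⟨hx, hy⟩
    · simpa using ⟨hx', hy'⟩
  have memΩ : ∀ p : Plane, ((p 0 = a ∨ p 0 = b) ∧ p 1 ∈ Icc c d ∨
      (p 1 = c ∨ p 1 = d) ∧ p 0 ∈ Icc a b) → p ∈ Ω := by
    intro p hp
    by_contra hpΩ
    obtain ⟨h1, h2⟩ := hcon p hpΩ
    rcases hp with ⟨h, h'⟩ | ⟨h, h'⟩
    · exact h1 h h'
    · exact h2 h h'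
  have hab : a ≤ b := by linarith
  have hcd : c ≤ d := by linarith
  have right := side b b c d 1 (fun p hp hp' => ⟨memΩ p
    (Or.inl ⟨Or.inr (by simpa using hp), hp'⟩), by
    simp only [Icc_self, mem_singleton_iff] at hp
    simp [hg, hp, hb]⟩) b d b c (by simp) (by simp [hcd]) (by simp) (by simp [hcd])
  have top := side a b d d (-Complex.I) (fun p hp hp' => ⟨memΩ p
    (Or.inr ⟨Or.inr (by simpa using hp'), hp⟩), by
    simp only [Icc_self, mem_singleton_iff] at hp'
    simp [hg, hp', hd]⟩) a d b d (by simp [hab]) (by simp) (by simp [hab]) (by simp)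
  have left := side a a c d (-1) (fun p hp hp' => ⟨memΩ p
    (Or.inl ⟨Or.inl (by simpa using hp), hp'⟩), by
    simp only [Icc_self, mem_singleton_iff] at hp
    simp [hg, hp, ha]⟩) a c a d (by simp) (by simp [hcd]) (by simp) (by simp [hcd])
  have bottom := side a b c c Complex.I (fun p hp hp' => ⟨memΩ p
    (Or.inr ⟨Or.inl (by simpa using hp'), hp⟩), by
    simp only [Icc_self, mem_singleton_iff] at hp'
    simp [hg, hp', hc]⟩) b c a c (by simp [hab]) (by simp) (by simp [hab]) (by simp)
  -- At each corner the branch on the next side is obtained from the one on the previous side by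
  -- a quarter turn; the four constants add up to `2 π I`, while `L` returns to its value.
  have c1 := log_neg_I_mul (w := 1 * g !₂[b, d]) (by simp [hg, hb]) (by simp [hg, hd])
  have c2 := log_neg_I_mul (w := -Complex.I * g !₂[a, d]) (by simp [hg, hd]) (by simp [hg, ha])
  have c3 := log_neg_I_mul (w := -1 * g !₂[a, c]) (by simp [hg, ha]) (by simp [hg, hc])
  have c4 := log_neg_I_mul (w := Complex.I * g !₂[b, c]) (by simp [hg, hc]) (by simp [hg, hb])
  rw [← mul_assoc] at c1 c2 c3 c4
  rw [show -Complex.I * 1 = -Complex.I by ring] at c1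
  rw [show -Complex.I * -Complex.I = -1 by simp] at c2
  rw [show -Complex.I * -1 = Complex.I by ring] at c3
  rw [show -Complex.I * Complex.I = 1 by simp] at c4
  rw [c1] at top
  rw [c2] at left
  rw [c3] at bottom
  rw [c4] at right
  have : 2 * (Real.pi : ℂ) * Complex.I = 0 := by linear_combination -right - top - left - bottom
  simp [Real.pi_ne_zero] at this

/-- Near a point `z` of the complement of a simply connected plane domain, for one of the two
coordinates, all the values on one side of `z` are taken by points of the complement close to
`z`. -/
theorem exists_side_forall_exists_notMem {Ω : Opens Plane}
    (hΩ : IsSimplyConnected (Ω : Set Plane)) {z : Plane} (hz : z ∉ Ω) (ρ : ℝ) :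
    ∃ (i : Fin 2) (c : ℝ), (c = z i - ρ ∨ c = z i) ∧
      ∀ t ∈ Ioo c (c + ρ), ∃ p ∉ Ω, p i = t ∧ ∀ j, |p j - z j| < ρ := by
  by_contra! hcon
  have key : ∀ (i : Fin 2) (c : ℝ), (c = z i - ρ ∨ c = z i) → ∃ t ∈ Ioo c (c + ρ), ∀ p : Plane,
      p i = t → (∀ j, |p j - z j| < ρ) → p ∈ Ω := by
    intro i c hc
    obtain ⟨t, ht, h⟩ := hcon i c hc
    refine ⟨t, ht, fun p hp hj => ?_⟩
    by_contra hpΩ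
    obtain ⟨j, hj'⟩ := h p hpΩ hp
    exact absurd (hj j) (not_lt.2 hj')
  obtain ⟨a, ha, hA⟩ := key 0 _ (Or.inl rfl)
  obtain ⟨b, hb, hB⟩ := key 0 _ (Or.inr rfl)
  obtain ⟨c, hc, hC⟩ := key 1 _ (Or.inl rfl)
  obtain ⟨d, hd, hD⟩ := key 1 _ (Or.inr rfl)
  rw [mem_Ioo] at ha hb hc hd
  obtain ⟨p, hp, h⟩ := exists_notMem_boundary_rectangle hΩ hz (a := a) (b := b) (c := c) (d := d)
    (by linarith) (by linarith) (by linarith) (by linarith)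
  have hj : ∀ j, |p j - z j| < ρ := by
    intro j
    rw [abs_lt]
    rcases h with ⟨h | h, h'⟩ | ⟨h | h, h'⟩ <;> rw [mem_Icc] at h' <;> fin_cases j <;>
      constructor <;> simp only [Fin.zero_eta, Fin.mk_one] <;> linarith
  rcases h with ⟨h | h, h'⟩ | ⟨h | h, h'⟩
  · exact hp (hA p h hj)
  · exact hp (hB p h hj)
  · exact hp (hC p h hj)
  · exact hp (hD p h hj)

/-! ### Dyadic cells -/

/-- The half-open square of side `h` of the grid `(hℤ)²` that contains `p`. -/
def gridCell (h : ℝ) (p : Plane) : Set Plane := {x | ∀ i, ⌊x i / h⌋ = ⌊p i / h⌋}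

theorem self_mem_gridCell (h : ℝ) (p : Plane) : p ∈ gridCell h p := fun _ => rfl

theorem gridCell_eq_of_mem {h : ℝ} {p q : Plane} (hq : q ∈ gridCell h p) :
    gridCell h q = gridCell h p := by
  ext x
  exact forall_congr' fun i => by rw [hq i]

theorem measurableSet_gridCell (h : ℝ) (p : Plane) : MeasurableSet (gridCell h p) := by
  have : gridCell h p = ⋂ i, (fun x : Plane => ⌊x i / h⌋) ⁻¹' {⌊p i / h⌋} := by
    ext x
    simp [gridCell]
  rw [this]
  refine MeasurableSet.iInter fun i => ?_
  have hm : Measurable fun x : Plane => ⌊x i / h⌋ := Int.measurable_floor.comp (by fun_prop)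
  exact hm (measurableSet_singleton _)

theorem setOf_floor_div_eq {h : ℝ} (hh : 0 < h) (m : ℤ) :
    {t : ℝ | ⌊t / h⌋ = m} = Ico (m * h) (m * h + h) := by
  ext t
  rw [mem_ofPred_eq, Int.floor_eq_iff, mem_Ico, le_div_iff₀ hh, div_lt_iff₀ hh]
  ring_nf

theorem volume_setOf_floor_div_eq {h : ℝ} (hh : 0 < h) (m : ℤ) :
    volume {t : ℝ | ⌊t / h⌋ = m} = ENNReal.ofReal h := by
  rw [setOf_floor_div_eq hh, Real.volume_Ico, add_sub_cancel_left]

theorem volume_gridCell {h : ℝ} (hh : 0 < h) (p : Plane) :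
    volume (gridCell h p) = ENNReal.ofReal (h ^ 2) := by
  have hpi : gridCell h p = (WithLp.ofLp : Plane → Fin 2 → ℝ) ⁻¹'
      (univ.pi fun i => {t : ℝ | ⌊t / h⌋ = ⌊p i / h⌋}) := by
    ext x
    simp [gridCell, mem_pi]
  have hm : ∀ m : ℤ, MeasurableSet {t : ℝ | ⌊t / h⌋ = m} := fun m => by
    rw [setOf_floor_div_eq hh]
    exact measurableSet_Ico
  rw [hpi, (PiLp.volume_preserving_ofLp (Fin 2)).measure_preimage
    (MeasurableSet.univ_pi fun i => hm _).nullMeasurableSet, volume_pi_pi]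
  simp [volume_setOf_floor_div_eq hh, ENNReal.ofReal_pow hh.le]

theorem norm_sub_le_of_mem_gridCell {h : ℝ} (hh : 0 < h) {p x y : Plane} (hx : x ∈ gridCell h p)
    (hy : y ∈ gridCell h p) : ‖x - y‖ ≤ 2 * h := by
  have key : ∀ i, |x i - y i| ≤ h := fun i => by
    have h1 := Int.abs_sub_lt_one_of_floor_eq_floor ((hx i).trans (hy i).symm)
    rw [← sub_div, abs_div, abs_of_pos hh, div_lt_one hh] at h1
    exact h1.le
  rw [EuclideanSpace.norm_eq, Fin.sum_univ_two]
  refine Real.sqrt_le_iff.2 ⟨by positivity, ?_⟩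
  have h0 := pow_le_pow_left₀ (abs_nonneg _) (key 0) 2
  have h1 := pow_le_pow_left₀ (abs_nonneg _) (key 1) 2
  simp only [PiLp.sub_apply, Real.norm_eq_abs]
  nlinarith

theorem gridCell_half_subset {h : ℝ} (p : Plane) : gridCell (h / 2) p ⊆ gridCell h p := by
  intro x hx i
  have key : ∀ t : ℝ, ⌊t / h⌋ = ⌊t / (h / 2)⌋ / 2 := fun t => by
    rw [show t / h = t / (h / 2) / (2 : ℕ) by push_cast; field_simp, Int.floor_div_natCast]
    rfl
  rw [key, key, hx i]

theorem gridCell_div_two_pow_subset {h : ℝ} (p : Plane) (n : ℕ) :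
    gridCell (h / 2 ^ n) p ⊆ gridCell h p := by
  induction n with
  | zero => simp
  | succ n ih =>
    refine subset_trans ?_ ih
    rw [pow_succ, ← div_div]
    exact gridCell_half_subset p

/-! ### Mean squares over dyadic cells -/

/-- The integrand of the Gagliardo-Slobodeckii seminorm. -/
noncomputable def gagliardoKernel (s : ℝ) (u : Plane → ℝ) (q : Plane × Plane) : ℝ≥0∞ :=
  ENNReal.ofReal (|u q.1 - u q.2| ^ 2 / ‖q.1 - q.2‖ ^ (2 + 2 * s))

theorem measurable_gagliardoKernel (s : ℝ) {u : Plane → ℝ} (hu : Measurable u) :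
    Measurable (gagliardoKernel s u) := by
  unfold gagliardoKernel
  fun_prop

theorem gagliardoENorm_sq (s : ℝ) (u : Plane → ℝ) :
    gagliardoENorm s u ^ 2 = ∫⁻ q, gagliardoKernel s u q := by
  rw [gagliardoENorm, ← ENNReal.rpow_natCast, ← ENNReal.rpow_mul]
  simp [gagliardoKernel]

/-- The mean value of `u²` over a cell of side `h`. -/
noncomputable def cellMeanSq (u : Plane → ℝ) (h : ℝ) (p : Plane) : ℝ≥0∞ :=
  (ENNReal.ofReal (h ^ 2))⁻¹ * ∫⁻ x in gridCell h p, ENNReal.ofReal (u x ^ 2)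

theorem sq_le_one_add_mul_sq_add {δ : ℝ} (hδ : 0 < δ) (a b : ℝ) :
    a ^ 2 ≤ (1 + δ) * b ^ 2 + (1 + δ⁻¹) * |a - b| ^ 2 := by
  have h1 : 0 ≤ (δ * b - (a - b)) ^ 2 * δ⁻¹ := by positivity
  have h2 : (δ * b - (a - b)) ^ 2 * δ⁻¹ = δ * b ^ 2 - 2 * b * (a - b) + δ⁻¹ * (a - b) ^ 2 := by
    field_simp
    ring
  rw [sq_abs]
  nlinarith

theorem ofReal_sq_le_gagliardoKernel {s : ℝ} (hs : 0 < s) (u : Plane → ℝ) {h : ℝ} (hh : 0 < h)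
    {x y : Plane} (hxy : ‖x - y‖ ≤ 2 * h) :
    ENNReal.ofReal (|u x - u y| ^ 2) ≤
      ENNReal.ofReal ((2 * h) ^ (2 + 2 * s)) * gagliardoKernel s u (x, y) := by
  rw [gagliardoKernel, ← ENNReal.ofReal_mul (by positivity)]
  refine ENNReal.ofReal_le_ofReal ?_
  simp only
  rcases eq_or_ne x y with rfl | hne
  · simp
  have h0 : 0 < ‖x - y‖ := norm_pos_iff.2 (sub_ne_zero.2 hne)
  rw [mul_div_assoc', le_div_iff₀ (by positivity), mul_comm]
  gcongr

/-- Passing from a cell to a dyadic subcell, up to a factor close to `1`. -/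
theorem cellMeanSq_le {s : ℝ} (hs : 0 < s) {u : Plane → ℝ} (hu : Measurable u) {h δ : ℝ}
    (hh : 0 < h) (hδ : 0 < δ) (p : Plane) :
    cellMeanSq u h p ≤ (1 + ENNReal.ofReal δ) * cellMeanSq u (h / 2) p +
      ENNReal.ofReal ((1 + δ⁻¹) * (4 * (h ^ 4)⁻¹ * (2 * h) ^ (2 + 2 * s))) *
        ∫⁻ q in gridCell h p ×ˢ gridCell h p, gagliardoKernel s u q := by
  set Q := gridCell h p
  set Q' := gridCell (h / 2) p
  set K := gagliardoKernel s u
  have hQ : MeasurableSet Q := measurableSet_gridCell h p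
  have hQ' : MeasurableSet Q' := measurableSet_gridCell (h / 2) p
  have hK : Measurable K := measurable_gagliardoKernel s hu
  have hsub : Q' ⊆ Q := gridCell_half_subset p
  -- Integrate a pointwise inequality over `x ∈ Q` and `y ∈ Q'`.
  set c : ℝ := (1 + δ⁻¹) * (2 * h) ^ (2 + 2 * s) with hc
  have hpt : ∀ x ∈ Q, ∀ y ∈ Q', ENNReal.ofReal (u x ^ 2) ≤
      (1 + ENNReal.ofReal δ) * ENNReal.ofReal (u y ^ 2) + ENNReal.ofReal c * K (x, y) := by
    intro x hx y hy
    calc ENNReal.ofReal (u x ^ 2)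
        ≤ ENNReal.ofReal ((1 + δ) * u y ^ 2 + (1 + δ⁻¹) * |u x - u y| ^ 2) :=
          ENNReal.ofReal_le_ofReal (sq_le_one_add_mul_sq_add hδ _ _)
      _ = (1 + ENNReal.ofReal δ) * ENNReal.ofReal (u y ^ 2) +
          ENNReal.ofReal (1 + δ⁻¹) * ENNReal.ofReal (|u x - u y| ^ 2) := by
          rw [ENNReal.ofReal_add (by positivity) (by positivity),
            ENNReal.ofReal_mul (by positivity), ENNReal.ofReal_mul (by positivity),
            ENNReal.ofReal_add zero_le_one hδ.le, ENNReal.ofReal_one]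
      _ ≤ _ := by
          rw [hc, ENNReal.ofReal_mul (by positivity), mul_assoc]
          gcongr
          exact ofReal_sq_le_gagliardoKernel hs u hh
            (norm_sub_le_of_mem_gridCell hh hx (hsub hy))
  have hvQ : volume Q = ENNReal.ofReal (h ^ 2) := volume_gridCell hh p
  have hvQ' : volume Q' = ENNReal.ofReal ((h / 2) ^ 2) := volume_gridCell (by positivity) p
  have hint : volume Q' * ∫⁻ x in Q, ENNReal.ofReal (u x ^ 2) ≤
      volume Q * ((1 + ENNReal.ofReal δ) * ∫⁻ y in Q', ENNReal.ofReal (u y ^ 2)) +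
        ENNReal.ofReal c * ∫⁻ q in Q ×ˢ Q, K q := by
    have e1 : volume Q' * ∫⁻ x in Q, ENNReal.ofReal (u x ^ 2) =
        ∫⁻ x in Q, ∫⁻ _y in Q', ENNReal.ofReal (u x ^ 2) := by
      simp only [lintegral_const, Measure.restrict_apply, MeasurableSet.univ, univ_inter]
      rw [lintegral_mul_const _ (by fun_prop), mul_comm]
    have e2 : ∫⁻ x in Q, ∫⁻ y in Q', ((1 + ENNReal.ofReal δ) * ENNReal.ofReal (u y ^ 2) +
          ENNReal.ofReal c * K (x, y)) =
        volume Q * ((1 + ENNReal.ofReal δ) * ∫⁻ y in Q', ENNReal.ofReal (u y ^ 2)) +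
        ENNReal.ofReal c * ∫⁻ q in Q ×ˢ Q', K q := by
      have : ∀ x, ∫⁻ y in Q', ((1 + ENNReal.ofReal δ) * ENNReal.ofReal (u y ^ 2) +
          ENNReal.ofReal c * K (x, y)) =
          (1 + ENNReal.ofReal δ) * (∫⁻ y in Q', ENNReal.ofReal (u y ^ 2)) +
            ENNReal.ofReal c * ∫⁻ y in Q', K (x, y) := fun x => by
        rw [lintegral_add_left (by fun_prop), lintegral_const_mul _ (by fun_prop),
          lintegral_const_mul _ (by fun_prop)]
      simp only [this]
      rw [lintegral_add_left (by fun_prop), lintegral_const, Measure.restrict_apply_univ,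
        lintegral_const_mul _ (by fun_prop), Measure.volume_eq_prod,
        setLIntegral_prod _ hK.aemeasurable, mul_comm (volume Q)]
    rw [e1]
    refine (setLIntegral_mono' hQ fun x hx => setLIntegral_mono' hQ' (hpt x hx)).trans ?_
    rw [e2]
    gcongr
  have hi : ∀ t : ℝ, 0 < t → (ENNReal.ofReal t)⁻¹ = ENNReal.ofReal t⁻¹ := fun t ht =>
    (ENNReal.ofReal_inv_of_pos ht).symm
  rw [hvQ, hvQ'] at hint
  have h1 := mul_le_mul_right hint (ENNReal.ofReal (4 * (h ^ 4)⁻¹))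
  rw [mul_add, ← mul_assoc, ← mul_assoc, ← mul_assoc (ENNReal.ofReal _) (ENNReal.ofReal c),
    ← ENNReal.ofReal_mul (by positivity), ← ENNReal.ofReal_mul (by positivity),
    ← ENNReal.ofReal_mul (by positivity)] at h1
  have e3 : 4 * (h ^ 4)⁻¹ * (h / 2) ^ 2 = (h ^ 2)⁻¹ := by field_simp; norm_num
  have e4 : 4 * (h ^ 4)⁻¹ * h ^ 2 = ((h / 2) ^ 2)⁻¹ := by field_simp; norm_num
  have e5 : 4 * (h ^ 4)⁻¹ * c = (1 + δ⁻¹) * (4 * (h ^ 4)⁻¹ * (2 * h) ^ (2 + 2 * s)) := by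
    rw [hc]; ring
  rw [e3, e4, e5] at h1
  rw [cellMeanSq, cellMeanSq, hi _ (by positivity), hi _ (by positivity)]
  refine h1.trans (le_of_eq ?_)
  ring

theorem tendsto_cellMeanSq_zero {u : Plane → ℝ} (hu : Continuous u) {p : Plane} (hp : u p = 0)
    {h : ℝ} (hh : 0 < h) :
    Filter.Tendsto (fun n : ℕ => cellMeanSq u (h / 2 ^ n) p) Filter.atTop (nhds 0) := by
  rw [ENNReal.tendsto_nhds_zero]
  intro ε hε
  have hc : ContinuousAt (fun x => ENNReal.ofReal (u x ^ 2)) p :=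
    (ENNReal.continuous_ofReal.comp (by fun_prop)).continuousAt
  have h0 : ∀ᶠ x in nhds p, ENNReal.ofReal (u x ^ 2) ≤ ε := by
    have := hc.tendsto
    simp only [hp] at this
    rw [zero_pow two_ne_zero, ENNReal.ofReal_zero, ENNReal.tendsto_nhds_zero] at this
    exact this ε hε
  obtain ⟨r, hr, hball⟩ := Metric.eventually_nhds_iff.1 h0
  have hlim : Filter.Tendsto (fun n : ℕ => 2 * (h / 2 ^ n)) Filter.atTop (nhds 0) := by
    have := (tendsto_pow_atTop_nhds_zero_of_lt_one (r := (1 / 2 : ℝ)) (by norm_num)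
      (by norm_num)).const_mul (2 * h)
    simp only [mul_zero] at this
    refine this.congr fun n => ?_
    rw [one_div, inv_pow]; ring
  filter_upwards [hlim.eventually_lt_const hr] with n hn
  have hhn : 0 < h / 2 ^ n := by positivity
  rw [cellMeanSq]
  calc (ENNReal.ofReal ((h / 2 ^ n) ^ 2))⁻¹ *
        ∫⁻ x in gridCell (h / 2 ^ n) p, ENNReal.ofReal (u x ^ 2)
      ≤ (ENNReal.ofReal ((h / 2 ^ n) ^ 2))⁻¹ * ∫⁻ _x in gridCell (h / 2 ^ n) p, ε := by
        refine mul_le_mul_right ?_ _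
        refine setLIntegral_mono' (measurableSet_gridCell _ _) fun x hx => hball ?_
        rw [dist_eq_norm]
        exact (norm_sub_le_of_mem_gridCell hhn hx (self_mem_gridCell _ _)).trans_lt hn
    _ = ε := by
        rw [lintegral_const, Measure.restrict_apply_univ, volume_gridCell hhn, mul_comm ε,
          ← mul_assoc, ENNReal.inv_mul_cancel (by simpa using by positivity) (by simp), one_mul]

theorem le_prod_mul_add_sum {a d δ : ℕ → ℝ≥0∞} (h : ∀ n, a n ≤ (1 + δ n) * a (n + 1) + d n)
    (N : ℕ) :
    a 0 ≤ (∏ n ∈ Finset.range N, (1 + δ n)) * (a N + ∑ n ∈ Finset.range N, d n) := by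
  induction N with
  | zero => simp
  | succ N ih =>
    refine ih.trans ?_
    rw [Finset.prod_range_succ, Finset.sum_range_succ, mul_assoc]
    gcongr
    calc a N + ∑ n ∈ Finset.range N, d n
        ≤ (1 + δ N) * a (N + 1) + d N + ∑ n ∈ Finset.range N, d n := by gcongr; exact h N
      _ ≤ (1 + δ N) * a (N + 1) + (1 + δ N) * d N + (1 + δ N) * ∑ n ∈ Finset.range N, d n := by
        gcongr <;> exact le_mul_of_one_le_left' le_self_add
      _ = _ := by ring

theorem le_mul_tsum_of_tendsto_zero {a d δ : ℕ → ℝ≥0∞} {P : ℝ≥0∞} (hP : P ≠ ∞)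
    (h : ∀ n, a n ≤ (1 + δ n) * a (n + 1) + d n)
    (hδ : ∀ N, ∏ n ∈ Finset.range N, (1 + δ n) ≤ P)
    (ha : Filter.Tendsto a Filter.atTop (nhds 0)) : a 0 ≤ P * ∑' n, d n := by
  have h1 : ∀ N, a 0 ≤ P * (a N + ∑' n, d n) := fun N => by
    refine (le_prod_mul_add_sum h N).trans ?_
    gcongr
    · exact hδ N
    · exact ENNReal.sum_le_tsum _
  have h2 : Filter.Tendsto (fun N => P * (a N + ∑' n, d n)) Filter.atTop
      (nhds (P * (0 + ∑' n, d n))) :=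
    ENNReal.Tendsto.const_mul (ha.add tendsto_const_nhds) (Or.inr hP)
  rw [zero_add] at h2
  exact ge_of_tendsto' h2 h1

/-! ### The Poincaré inequality in a cell -/

/-- The part of the Gagliardo-Slobodeckii energy of `T ×ˢ T` that comes from the column of width
`h`, orthogonal to the coordinate `i`, that contains the points with coordinate `t`. -/
noncomputable def columnEnergy (s : ℝ) (u : Plane → ℝ) (T : Set Plane) (i : Fin 2) (h t : ℝ) :
    ℝ≥0∞ :=
  ∫⁻ q in T ×ˢ T, {q : Plane × Plane | ⌊q.1 i / h⌋ = ⌊t / h⌋}.indicator (gagliardoKernel s u) q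

theorem measurableSet_floor_eq_floor (i : Fin 2) (h : ℝ) :
    MeasurableSet {r : ℝ × (Plane × Plane) | ⌊r.2.1 i / h⌋ = ⌊r.1 / h⌋} := by
  refine measurableSet_eq_fun ?_ ?_
  · exact Int.measurable_floor.comp (by fun_prop)
  · exact Int.measurable_floor.comp (by fun_prop)

theorem measurable_indicator_gagliardoKernel (s : ℝ) {u : Plane → ℝ} (hu : Measurable u)
    (i : Fin 2) (h : ℝ) :
    Measurable fun r : ℝ × (Plane × Plane) =>
      {q : Plane × Plane | ⌊q.1 i / h⌋ = ⌊r.1 / h⌋}.indicator (gagliardoKernel s u) r.2 := by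
  have := ((measurable_gagliardoKernel s hu).comp measurable_snd).indicator
    (measurableSet_floor_eq_floor i h)
  exact this

theorem measurable_columnEnergy (s : ℝ) {u : Plane → ℝ} (hu : Measurable u) (T : Set Plane)
    (i : Fin 2) (h : ℝ) : Measurable (columnEnergy s u T i h) :=
  (measurable_indicator_gagliardoKernel s hu i h).lintegral_prod_right'

theorem lintegral_columnEnergy (s : ℝ) {u : Plane → ℝ} (hu : Measurable u) (T : Set Plane)
    (i : Fin 2) {h : ℝ} (hh : 0 < h) :
    ∫⁻ t, columnEnergy s u T i h t =
      ENNReal.ofReal h * ∫⁻ q in T ×ˢ T, gagliardoKernel s u q := by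
  unfold columnEnergy
  rw [lintegral_lintegral_swap (measurable_indicator_gagliardoKernel s hu i h).aemeasurable,
    ← lintegral_const_mul _ (measurable_gagliardoKernel s hu)]
  refine lintegral_congr fun q => ?_
  have : ∀ t : ℝ, {q : Plane × Plane | ⌊q.1 i / h⌋ = ⌊t / h⌋}.indicator (gagliardoKernel s u) q =
      {t : ℝ | ⌊t / h⌋ = ⌊q.1 i / h⌋}.indicator (fun _ => gagliardoKernel s u q) t := fun t => by
    by_cases hq : ⌊q.1 i / h⌋ = ⌊t / h⌋
    · rw [indicator_of_mem (by exact hq), indicator_of_mem (by exact hq.symm)]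
    · rw [indicator_of_notMem (by exact hq), indicator_of_notMem (by exact fun h' => hq h'.symm)]
  simp only [this]
  rw [lintegral_indicator_const, volume_setOf_floor_div_eq hh, mul_comm]
  rw [setOf_floor_div_eq hh]
  exact measurableSet_Ico

theorem lintegral_gridCell_prod_le_columnEnergy (s : ℝ) (u : Plane → ℝ) {h : ℝ} {p x : Plane}
    (hx : x ∈ gridCell h p) (i : Fin 2) (n : ℕ) :
    ∫⁻ q in gridCell (h / 2 ^ n) x ×ˢ gridCell (h / 2 ^ n) x, gagliardoKernel s u q ≤
      columnEnergy s u (gridCell h p) i (h / 2 ^ n) (x i) := by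
  have hsub : gridCell (h / 2 ^ n) x ⊆ gridCell h p := by
    rw [← gridCell_eq_of_mem hx]
    exact gridCell_div_two_pow_subset x n
  have hm := (measurableSet_gridCell (h / 2 ^ n) x).prod (measurableSet_gridCell (h / 2 ^ n) x)
  calc _ = ∫⁻ q in gridCell (h / 2 ^ n) x ×ˢ gridCell (h / 2 ^ n) x,
        {q : Plane × Plane | ⌊q.1 i / (h / 2 ^ n)⌋ = ⌊x i / (h / 2 ^ n)⌋}.indicator
          (gagliardoKernel s u) q :=
        setLIntegral_congr_fun hm fun q hq =>
          (indicator_of_mem (by exact hq.1 i) (gagliardoKernel s u)).symm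
    _ ≤ _ := lintegral_mono_set (prod_mono hsub hsub)

theorem prod_one_add_pow_le {r : ℝ} (hr0 : 0 ≤ r) (hr1 : r < 1) (N : ℕ) :
    ∏ n ∈ Finset.range N, (1 + ENNReal.ofReal (r ^ n)) ≤ ENNReal.ofReal (Real.exp (1 - r)⁻¹) := by
  have h1 : ∀ n : ℕ, 1 + ENNReal.ofReal (r ^ n) = ENNReal.ofReal (1 + r ^ n) := fun n => by
    rw [ENNReal.ofReal_add zero_le_one (by positivity), ENNReal.ofReal_one]
  simp only [h1]
  rw [← ENNReal.ofReal_prod_of_nonneg fun n _ => by positivity]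
  refine ENNReal.ofReal_le_ofReal ?_
  calc ∏ n ∈ Finset.range N, (1 + r ^ n) ≤ ∏ n ∈ Finset.range N, Real.exp (r ^ n) :=
        Finset.prod_le_prod (fun n _ => by positivity) fun n _ => by
          rw [add_comm]; exact Real.add_one_le_exp _
    _ = Real.exp (∑ n ∈ Finset.range N, r ^ n) := (Real.exp_sum _ _).symm
    _ ≤ Real.exp (1 - r)⁻¹ := by
        rw [← tsum_geometric_of_lt_one hr0 hr1]
        exact Real.exp_le_exp.2 ((summable_geometric_of_lt_one hr0 hr1).sum_le_tsum _
          fun n _ => by positivity)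

/-- The convergence of this series is where `1 / 2 < s` is used: the energy of a square of side `h`
controls `h ^ (2 s - 2)` times the square of the oscillation, and a further factor `h` comes from
the integration over columns. -/
theorem tsum_dyadic_ne_top {s : ℝ} (hs : 1 / 2 < s) {h : ℝ} (hh : 0 < h) :
    ∑' n : ℕ, ENNReal.ofReal ((1 + (((2 : ℝ) ^ (1 / 2 - s)) ^ n)⁻¹) *
        (4 * ((h / 2 ^ n) ^ 4)⁻¹ * (2 * (h / 2 ^ n)) ^ (2 + 2 * s))) *
      ENNReal.ofReal (h / 2 ^ n) ≠ ∞ := by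
  set r : ℝ := (2 : ℝ) ^ (1 / 2 - s) with hr
  have hr0 : 0 < r := by positivity
  have hr1 : r < 1 := Real.rpow_lt_one_of_one_lt_of_neg one_lt_two (by linarith)
  set B : ℝ := 4 * 2 ^ (2 + 2 * s) * h ^ (2 * s - 1) with hB
  have hB0 : 0 ≤ B := by positivity
  have hterm : ∀ n : ℕ, ENNReal.ofReal ((1 + (r ^ n)⁻¹) *
      (4 * ((h / 2 ^ n) ^ 4)⁻¹ * (2 * (h / 2 ^ n)) ^ (2 + 2 * s))) * ENNReal.ofReal (h / 2 ^ n) ≤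
      ENNReal.ofReal (2 * B * r ^ n) := by
    intro n
    rw [← ENNReal.ofReal_mul (by positivity)]
    refine ENNReal.ofReal_le_ofReal ?_
    have hk : 0 < h / 2 ^ n := by positivity
    have e1 : (h / 2 ^ n) ^ (2 * s - 1) = h ^ (2 * s - 1) * (r ^ n) ^ 2 := by
      rw [Real.div_rpow hh.le (by positivity), hr, ← Real.rpow_natCast, ← Real.rpow_natCast,
        ← Real.rpow_natCast, ← Real.rpow_mul (by norm_num), ← Real.rpow_mul (by positivity),
        ← Real.rpow_mul (by positivity), div_eq_mul_inv, ← Real.rpow_neg (by norm_num)]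
      congr 2
      push_cast
      ring
    have e2 : (2 * (h / 2 ^ n)) ^ (2 + 2 * s) =
        2 ^ (2 + 2 * s) * ((h / 2 ^ n) ^ (2 * s - 1) * (h / 2 ^ n) ^ 3) := by
      rw [Real.mul_rpow (by norm_num) hk.le]
      congr 1
      rw [← Real.rpow_natCast (h / 2 ^ n) 3, ← Real.rpow_add hk]
      congr 1
      push_cast
      ring
    have e3 : (1 + (r ^ n)⁻¹) * (4 * ((h / 2 ^ n) ^ 4)⁻¹ * (2 * (h / 2 ^ n)) ^ (2 + 2 * s)) *
        (h / 2 ^ n) = B * ((r ^ n) ^ 2 + r ^ n) := by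
      rw [e2, e1, hB]
      have : r ^ n ≠ 0 := by positivity
      field_simp
    rw [e3, mul_comm 2 B, mul_assoc B]
    refine mul_le_mul_of_nonneg_left ?_ hB0
    have h1 : r ^ n ≤ 1 := pow_le_one₀ hr0.le hr1.le
    have h2 : 0 < r ^ n := by positivity
    nlinarith
  refine ne_top_of_le_ne_top ?_ (ENNReal.tsum_le_tsum hterm)
  exact ((summable_geometric_of_lt_one hr0.le hr1).mul_left _).tsum_ofReal_ne_top

/-- If `u` vanishes somewhere on each of the lines `x i = t`, `t ∈ J`, in a square, then the mean of
`u²` over that square is controlled by the energy of `u` in it. For each `t ∈ J` the squares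
shrinking to the zero of `u` on that line are compared successively; the loss is the energy of these
squares, which depends on an unknown point but is dominated by the energy of columns, and the latter
can be integrated in `t`. -/
theorem volume_mul_cellMeanSq_le {s : ℝ} (hs : 1 / 2 < s) {h : ℝ} (hh : 0 < h) :
    ∃ C : ℝ≥0∞, C ≠ ∞ ∧ ∀ u : Plane → ℝ, Continuous u → ∀ (p : Plane) (i : Fin 2) (J : Set ℝ),
      MeasurableSet J → (∀ t ∈ J, ∃ x ∈ gridCell h p, x i = t ∧ u x = 0) →
      volume J * cellMeanSq u h p ≤
        C * ∫⁻ q in gridCell h p ×ˢ gridCell h p, gagliardoKernel s u q := by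
  set r : ℝ := (2 : ℝ) ^ (1 / 2 - s) with hr
  have hr0 : 0 < r := by positivity
  have hr1 : r < 1 := Real.rpow_lt_one_of_one_lt_of_neg one_lt_two (by linarith)
  set c : ℕ → ℝ≥0∞ := fun n => ENNReal.ofReal ((1 + (r ^ n)⁻¹) *
    (4 * ((h / 2 ^ n) ^ 4)⁻¹ * (2 * (h / 2 ^ n)) ^ (2 + 2 * s))) with hc
  set P : ℝ≥0∞ := ENNReal.ofReal (Real.exp (1 - r)⁻¹) with hP
  refine ⟨P * ∑' n, c n * ENNReal.ofReal (h / 2 ^ n),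
    ENNReal.mul_ne_top ENNReal.ofReal_ne_top (tsum_dyadic_ne_top hs hh), ?_⟩
  intro u hu p i J hJ hzero
  set T := gridCell h p
  have hcol : ∀ n, Measurable (columnEnergy s u T i (h / 2 ^ n)) := fun n =>
    measurable_columnEnergy s hu.measurable T i _
  have hpt : ∀ t ∈ J, cellMeanSq u h p ≤ P * ∑' n, c n * columnEnergy s u T i (h / 2 ^ n) t := by
    intro t ht
    obtain ⟨x, hxT, rfl, hux⟩ := hzero t ht
    have hstep : ∀ n : ℕ, cellMeanSq u (h / 2 ^ n) x ≤
        (1 + ENNReal.ofReal (r ^ n)) * cellMeanSq u (h / 2 ^ (n + 1)) x +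
          c n * columnEnergy s u T i (h / 2 ^ n) (x i) := fun n => by
      rw [pow_succ 2 n, ← div_div]
      refine (cellMeanSq_le (s := s) (δ := r ^ n) (by linarith) hu.measurable (by positivity)
        (by positivity) x).trans ?_
      gcongr
      exact lintegral_gridCell_prod_le_columnEnergy s u hxT i n
    have h0 := le_mul_tsum_of_tendsto_zero ENNReal.ofReal_ne_top hstep
      (prod_one_add_pow_le hr0.le hr1) (tendsto_cellMeanSq_zero hu hux hh)
    have hcell : cellMeanSq u (h / 2 ^ 0) x = cellMeanSq u h p := by
      rw [pow_zero, div_one, cellMeanSq, cellMeanSq, gridCell_eq_of_mem hxT]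
    rwa [hcell] at h0
  calc volume J * cellMeanSq u h p = ∫⁻ _t in J, cellMeanSq u h p := by
        rw [lintegral_const, Measure.restrict_apply_univ, mul_comm]
    _ ≤ ∫⁻ t in J, P * ∑' n, c n * columnEnergy s u T i (h / 2 ^ n) t :=
        setLIntegral_mono' hJ hpt
    _ ≤ ∫⁻ t, P * ∑' n, c n * columnEnergy s u T i (h / 2 ^ n) t := setLIntegral_le_lintegral _ _
    _ = P * ∑' n, c n * ∫⁻ t, columnEnergy s u T i (h / 2 ^ n) t := by
        rw [lintegral_const_mul _ (Measurable.tsum fun n => (hcol n).const_mul _),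
          lintegral_tsum fun n => ((hcol n).const_mul _).aemeasurable]
        congr 2
        funext n
        rw [lintegral_const_mul _ (hcol n)]
    _ = _ := by
        rw [mul_assoc, ← ENNReal.tsum_mul_right]
        congr 2
        funext n
        rw [lintegral_columnEnergy s hu.measurable T i (by positivity), mul_assoc]

/-! ### The Poincaré inequality in simply connected domains -/

theorem mem_gridCell_center {h : ℝ} (hh : 0 < h) (k : Fin 2 → ℤ) (x : Plane) :
    x ∈ gridCell h (WithLp.toLp 2 fun i => (k i + 1 / 2) * h) ↔ ∀ i, ⌊x i / h⌋ = k i := by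
  refine forall_congr' fun i => ?_
  have : ⌊((k i : ℝ) + 1 / 2) * h / h⌋ = k i := by
    rw [mul_div_cancel_right₀ _ hh.ne', Int.floor_eq_iff]
    constructor <;> linarith
  rw [PiLp.toLp_apply, this]

theorem iUnion_gridCell {h : ℝ} (hh : 0 < h) :
    ⋃ k : Fin 2 → ℤ, gridCell h (WithLp.toLp 2 fun i => (k i + 1 / 2) * h) = univ :=
  eq_univ_of_forall fun x => mem_iUnion.2
    ⟨fun i => ⌊x i / h⌋, (mem_gridCell_center hh _ x).2 fun _ => rfl⟩

theorem pairwise_disjoint_gridCell {h : ℝ} (hh : 0 < h) :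
    Pairwise (Function.onFun Disjoint fun k : Fin 2 → ℤ =>
      gridCell h (WithLp.toLp 2 fun i => (k i + 1 / 2) * h)) := by
  intro k l hkl
  refine Set.disjoint_left.2 fun x hx hx' => hkl ?_
  rw [mem_gridCell_center hh] at hx hx'
  funext i
  rw [← hx i, hx' i]

/-- A Poincaré inequality holds for functions that vanish on enough points of each cell of a
grid. -/
theorem lintegral_sq_le_of_forall_gridCell {s : ℝ} (hs : 1 / 2 < s) {h : ℝ} (hh : 0 < h) :
    ∃ C : ℝ≥0∞, C ≠ ∞ ∧ ∀ u : Plane → ℝ, Continuous u →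
      (∀ k : Fin 2 → ℤ, ∃ (i : Fin 2) (c : ℝ), ∀ t ∈ Ioo c (c + h / 4),
        ∃ x ∈ gridCell h (WithLp.toLp 2 fun i => (k i + 1 / 2) * h), x i = t ∧ u x = 0) →
      ∫⁻ x, ENNReal.ofReal (u x ^ 2) ≤ C * ∫⁻ q, gagliardoKernel s u q := by
  obtain ⟨C, hC, hCu⟩ := volume_mul_cellMeanSq_le hs hh
  refine ⟨ENNReal.ofReal (h ^ 2) * (ENNReal.ofReal (h / 4))⁻¹ * C, ENNReal.mul_ne_top
    (ENNReal.mul_ne_top ENNReal.ofReal_ne_top (by simpa using hh)) hC, ?_⟩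
  intro u hu hzero
  set T : (Fin 2 → ℤ) → Set Plane := fun k =>
    gridCell h (WithLp.toLp 2 fun i => (k i + 1 / 2) * h)
  have hT : ∀ k, MeasurableSet (T k) := fun k => measurableSet_gridCell _ _
  have hdisj : Pairwise (Function.onFun Disjoint T) := pairwise_disjoint_gridCell hh
  have hcell : ∀ k, ∫⁻ x in T k, ENNReal.ofReal (u x ^ 2) ≤
      ENNReal.ofReal (h ^ 2) * (ENNReal.ofReal (h / 4))⁻¹ * C *
        ∫⁻ q in T k ×ˢ T k, gagliardoKernel s u q := by
    intro k
    obtain ⟨i, c, hic⟩ := hzero k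
    have h1 := hCu u hu _ i _ measurableSet_Ioo hic
    rw [Real.volume_Ioo, add_sub_cancel_left, cellMeanSq] at h1
    have h2 : ENNReal.ofReal (h ^ 2) ≠ 0 := by simpa using hh.ne'
    have h4 : ENNReal.ofReal (h / 4) ≠ 0 := by simpa using hh
    have h3 := mul_le_mul_right h1 (ENNReal.ofReal (h ^ 2) * (ENNReal.ofReal (h / 4))⁻¹)
    rw [← mul_assoc _ C] at h3
    refine le_trans (le_of_eq ?_) h3
    calc ∫⁻ x in T k, ENNReal.ofReal (u x ^ 2)
        = (ENNReal.ofReal (h ^ 2) * (ENNReal.ofReal (h ^ 2))⁻¹) *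
          ((ENNReal.ofReal (h / 4))⁻¹ * ENNReal.ofReal (h / 4)) *
          ∫⁻ x in T k, ENNReal.ofReal (u x ^ 2) := by
          rw [ENNReal.mul_inv_cancel h2 ENNReal.ofReal_ne_top,
            ENNReal.inv_mul_cancel h4 ENNReal.ofReal_ne_top, one_mul, one_mul]
      _ = _ := by ring
  calc ∫⁻ x, ENNReal.ofReal (u x ^ 2) = ∑' k, ∫⁻ x in T k, ENNReal.ofReal (u x ^ 2) := by
        rw [← lintegral_iUnion hT hdisj, iUnion_gridCell hh, setLIntegral_univ]
    _ ≤ ∑' k, ENNReal.ofReal (h ^ 2) * (ENNReal.ofReal (h / 4))⁻¹ * C *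
          ∫⁻ q in T k ×ˢ T k, gagliardoKernel s u q := ENNReal.tsum_le_tsum hcell
    _ = ENNReal.ofReal (h ^ 2) * (ENNReal.ofReal (h / 4))⁻¹ * C *
          ∫⁻ q in ⋃ k, T k ×ˢ T k, gagliardoKernel s u q := by
        rw [ENNReal.tsum_mul_left, lintegral_iUnion fun k => (hT k).prod (hT k)]
        intro k l hkl
        exact Disjoint.set_prod_left (hdisj hkl) _ _
    _ ≤ _ := by
        gcongr
        exact Measure.restrict_le_self

theorem exists_pos_forall_exists_notMem_dist_lt {Ω : Opens Plane}
    (h : inradius (Ω : Set Plane) < ∞) :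
    ∃ ρ : ℝ, 0 < ρ ∧ ∀ x : Plane, ∃ z ∉ Ω, dist z x < ρ := by
  refine ⟨(inradius (Ω : Set Plane)).toReal + 1, by positivity, fun x => ?_⟩
  set ρ := (inradius (Ω : Set Plane)).toReal + 1 with hρ
  have hρ0 : 0 < ρ := by positivity
  by_cases hx : x ∈ Ω
  · by_contra! hcon
    have hball : Metric.ball x ρ ⊆ Ω := fun y hy => by
      by_contra hyΩ
      exact absurd (hcon y hyΩ) (not_le.2 hy)
    have h1 : ENNReal.ofReal ρ ≤ inradius (Ω : Set Plane) :=
      le_iSup₂_of_le (f := fun (ρ : ℝ) (_ : 0 < ρ ∧ ∃ x ∈ (Ω : Set Plane),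
        Metric.ball x ρ ⊆ Ω) => ENNReal.ofReal ρ) ρ ⟨hρ0, x, hx, hball⟩ le_rfl
    rw [ENNReal.ofReal_le_iff_le_toReal h.ne] at h1
    linarith
  · exact ⟨x, hx, by simpa using hρ0⟩

/-- The fractional Poincaré inequality in a simply connected plane domain of finite inradius. -/
theorem exists_lintegral_sq_le {s : ℝ} (hs : 1 / 2 < s) {Ω : Opens Plane}
    (hΩ : IsSimplyConnected (Ω : Set Plane)) (hr : inradius (Ω : Set Plane) < ∞) :
    ∃ C : ℝ≥0∞, C ≠ ∞ ∧ ∀ u : Plane → ℝ, Continuous u → (∀ x ∉ Ω, u x = 0) →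
      ∫⁻ x, ENNReal.ofReal (u x ^ 2) ≤ C * ∫⁻ q, gagliardoKernel s u q := by
  obtain ⟨ρ, hρ, hz⟩ := exists_pos_forall_exists_notMem_dist_lt hr
  -- A cell of side `4 ρ` contains all points whose coordinates differ by less than `2 ρ` from
  -- those of its centre.
  have h4 : 0 < 4 * ρ := by positivity
  obtain ⟨C, hC, hCu⟩ := lintegral_sq_le_of_forall_gridCell hs h4
  refine ⟨C, hC, fun u hu hzero => hCu u hu fun k => ?_⟩
  obtain ⟨z, hzΩ, hdist⟩ := hz (WithLp.toLp 2 fun i => ((k i : ℝ) + 1 / 2) * (4 * ρ))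
  obtain ⟨i, c, -, hc⟩ := exists_side_forall_exists_notMem hΩ hzΩ ρ
  refine ⟨i, c, fun t ht => ?_⟩
  rw [mul_div_cancel_left₀ _ (by norm_num : (4 : ℝ) ≠ 0)] at ht
  obtain ⟨p, hp, hpi, hpj⟩ := hc t ht
  refine ⟨p, (mem_gridCell_center h4 k p).2 fun j => ?_, hpi, hzero p hp⟩
  have h1 : |z j - (k j + 1 / 2) * (4 * ρ)| < ρ := by
    refine lt_of_le_of_lt ?_ hdist
    rw [dist_eq_norm]
    exact PiLp.norm_apply_le (z - WithLp.toLp 2 fun i => ((k i : ℝ) + 1 / 2) * (4 * ρ)) j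
  have h2 := abs_lt.1 (hpj j)
  rw [abs_lt] at h1
  rw [Int.floor_eq_iff, le_div_iff₀ h4, div_lt_iff₀ h4]
  constructor <;> linarith [h1.1, h1.2, h2.1, h2.2]

/-! ### Identification of the two spaces and the Poincaré inequality -/

theorem gagliardoENorm_le_of_ae_tendsto (s : ℝ) {v : ℕ → Plane → ℝ} {u : Plane → ℝ} {B : ℝ≥0∞}
    (hv : ∀ n, AEStronglyMeasurable (v n) volume)
    (h : ∀ᵐ x, Filter.Tendsto (fun n => v n x) Filter.atTop (nhds (u x)))
    (hB : ∀ᶠ n in Filter.atTop, gagliardoENorm s (v n) ≤ B) : gagliardoENorm s u ≤ B := by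
  simp only [gagliardoENorm_eq_eLpNorm] at hB ⊢
  refine Lp.eLpNorm_le_of_ae_tendsto hB (fun n => aestronglyMeasurable_gagliardo s (hv n)) ?_
  have h1 := (Measure.quasiMeasurePreserving_fst (μ := (volume : Measure Plane))
    (ν := (volume : Measure Plane))).ae h
  have h2 := (Measure.quasiMeasurePreserving_snd (μ := (volume : Measure Plane))
    (ν := (volume : Measure Plane))).ae h
  filter_upwards [h1, h2] with p hp1 hp2
  exact (hp1.sub hp2).div_const _

namespace FracSobolev

variable {s : Ioo (0 : ℝ) 1}

theorem norm_toLp_le (u : FracSobolev s) : ‖u.toLp‖ ≤ ‖u‖ := by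
  rw [norm_def]
  exact le_add_of_nonneg_right ENNReal.toReal_nonneg

theorem gagliardoENorm_le (u : FracSobolev s) :
    gagliardoENorm s u.toLp ≤ ENNReal.ofReal ‖u‖ := by
  rw [← ENNReal.ofReal_toReal (show gagliardoENorm s u.toLp ≠ ∞ from u.2.ne)]
  refine ENNReal.ofReal_le_ofReal ?_
  rw [norm_def]
  exact le_add_of_nonneg_left (norm_nonneg _)

instance : CompleteSpace (FracSobolev s) := by
  refine Metric.complete_of_cauchySeq_tendsto fun u hu => ?_
  have hLp : CauchySeq fun n => (u n).toLp := by
    rw [Metric.cauchySeq_iff] at hu ⊢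
    intro ε hε
    obtain ⟨N, hN⟩ := hu ε hε
    refine ⟨N, fun m hm n hn => lt_of_le_of_lt ?_ (hN m hm n hn)⟩
    rw [dist_eq_norm, dist_eq_norm]
    exact norm_toLp_le (u m - u n)
  obtain ⟨v, hv⟩ := cauchySeq_tendsto_of_complete hLp
  obtain ⟨ns, hns, hae⟩ := (tendstoInMeasure_of_tendsto_Lp hv).exists_seq_tendsto_ae
  -- By Fatou's lemma, the seminorm of the differences with the limit is small.
  have hfatou : ∀ ε > 0, ∃ N, ∀ m ≥ N,
      gagliardoENorm s (v - (u m).toLp : Lp ℝ 2 (volume : Measure Plane)) ≤ ENNReal.ofReal ε := by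
    intro ε hε
    obtain ⟨N, hN⟩ := Metric.cauchySeq_iff.1 hu ε hε
    refine ⟨N, fun m hm => ?_⟩
    refine gagliardoENorm_le_of_ae_tendsto s
      (v := fun k => (((u (ns k)).toLp - (u m).toLp : Lp ℝ 2 (volume : Measure Plane)) :
        Plane → ℝ)) (fun k => Lp.aestronglyMeasurable _) ?_ ?_
    · have hsub : ∀ᵐ x, ∀ k, ((u (ns k)).toLp - (u m).toLp : Lp ℝ 2 (volume : Measure Plane)) x =
          (u (ns k)).toLp x - (u m).toLp x := by
        rw [ae_all_iff]
        exact fun k => Lp.coeFn_sub _ _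
      filter_upwards [hae, hsub, Lp.coeFn_sub v (u m).toLp] with x h1 h2 h3
      rw [h3, Pi.sub_apply]
      simp only [h2]
      exact h1.sub_const _
    · filter_upwards [hns.tendsto_atTop.eventually_ge_atTop N] with k hk
      have h1 := (hN (ns k) hk m hm).le
      rw [dist_eq_norm] at h1
      exact (gagliardoENorm_le (u (ns k) - u m)).trans (ENNReal.ofReal_le_ofReal h1)
  have hmem : ∃ w : FracSobolev s, w.toLp = v := by
    obtain ⟨N, hN⟩ := hfatou 1 one_pos
    have h1 : v - (u N).toLp ∈ fracSobolevSubmodule s :=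
      (hN N le_rfl).trans_lt ENNReal.ofReal_lt_top
    have h2 := Submodule.add_mem _ h1 (u N).2
    rw [show v - (u N).toLp + (u N).1 = v from sub_add_cancel v _] at h2
    exact ⟨⟨v, h2⟩, rfl⟩
  obtain ⟨w, rfl⟩ := hmem
  refine ⟨w, ?_⟩
  rw [Metric.tendsto_atTop] at hv ⊢
  intro ε hε
  obtain ⟨N₁, hN₁⟩ := hv (ε / 2) (by positivity)
  obtain ⟨N₂, hN₂⟩ := hfatou (ε / 4) (by positivity)
  refine ⟨max N₁ N₂, fun n hn => ?_⟩
  have h1 := hN₁ n (le_of_max_le_left hn)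
  have h2 := ENNReal.toReal_mono ENNReal.ofReal_ne_top (hN₂ n (le_of_max_le_right hn))
  rw [ENNReal.toReal_ofReal (by positivity)] at h2
  rw [dist_comm, dist_eq_norm] at h1 ⊢
  rw [norm_def]
  change ‖w.toLp - (u n).toLp‖ + (gagliardoENorm s (w.toLp - (u n).toLp :
    Lp ℝ 2 (volume : Measure Plane))).toReal < ε
  linarith

end FracSobolev

section Identification

variable (s : Ioo (0 : ℝ) 1) (Ω : Opens Plane)

instance : CompleteSpace (fracSobolevZero s Ω) :=
  (Submodule.isClosed_topologicalClosure _).completeSpace_coe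

/-- The inclusion of `C_c^∞(Ω)` into `𝒟₀^{s,2}(Ω)` as a linear map. -/
noncomputable def testToHomogeneousₗ : 𝓓(Ω, ℝ) →ₗ[ℝ] HomogeneousSobolev s Ω where
  toFun := testToHomogeneous s
  map_add' u v := UniformSpace.Completion.coe_add (HomogeneousTest.of s u) (HomogeneousTest.of s v)
  map_smul' c u := UniformSpace.Completion.coe_smul c (HomogeneousTest.of s u)

/-- The inclusion of `C_c^∞(Ω)` into `W̃₀^{s,2}(Ω)` as a linear map. -/
noncomputable def testToFracSobolevZeroₗ : 𝓓(Ω, ℝ) →ₗ[ℝ] fracSobolevZero s Ω where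
  toFun := testToFracSobolevZero s
  map_add' _ _ := rfl
  map_smul' _ _ := rfl

variable {Ω}

theorem norm_testToHomogeneous (u : 𝓓(Ω, ℝ)) :
    ‖testToHomogeneous s u‖ = (gagliardoENorm s u).toReal := by
  rw [testToHomogeneous, UniformSpace.Completion.norm_coe]
  rfl

theorem norm_testToFracSobolevZero (u : 𝓓(Ω, ℝ)) :
    ‖testToFracSobolevZero s u‖ =
      ‖(memLp_testFunction u).toLp u‖ + (gagliardoENorm s u).toReal := by
  change ‖(memLp_testFunction u).toLp u‖ +
    (gagliardoENorm s ((memLp_testFunction u).toLp u)).toReal = _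
  rw [gagliardoENorm_congr s (memLp_testFunction u).coeFn_toLp]

theorem denseRange_testToHomogeneous : DenseRange (testToHomogeneousₗ s Ω) :=
  UniformSpace.Completion.denseRange_coe (α := HomogeneousTest s Ω)

theorem denseRange_testToFracSobolevZero : DenseRange (testToFracSobolevZeroₗ s Ω) := by
  intro x
  rw [closure_subtype]
  have hx : (x : FracSobolev s) ∈ closure (LinearMap.range (testToFracSobolev s Ω) :
      Set (FracSobolev s)) := x.2
  convert! hx
  ext y
  constructor
  · rintro ⟨_, ⟨u, rfl⟩, rfl⟩
    exact ⟨u, rfl⟩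
  · rintro ⟨u, rfl⟩
    exact ⟨_, ⟨u, rfl⟩, rfl⟩

/-- A Poincaré inequality on `C_c^∞(Ω)` identifies the two spaces. -/
theorem exists_equiv_of_poincare {C : ℝ}
    (h : ∀ u : 𝓓(Ω, ℝ), ‖(memLp_testFunction u).toLp u‖ ≤ C * (gagliardoENorm s u).toReal) :
    ∃ e : HomogeneousSobolev s Ω ≃L[ℝ] fracSobolevZero s Ω,
      ∀ u : 𝓓(Ω, ℝ), e (testToHomogeneous s u) = testToFracSobolevZero s u := by
  have h1 : ∃ C, ∀ u, ‖testToFracSobolevZeroₗ s Ω (LinearEquiv.refl ℝ 𝓓(Ω, ℝ) u)‖ ≤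
      C * ‖testToHomogeneousₗ s Ω u‖ := by
    refine ⟨C + 1, fun u => ?_⟩
    refine (norm_testToFracSobolevZero s u).le.trans ?_
    refine le_trans ?_ (congrArg (fun t => (C + 1) * t) (norm_testToHomogeneous s u)).ge
    linarith [h u]
  have h2 : ∃ C, ∀ u, ‖testToHomogeneousₗ s Ω ((LinearEquiv.refl ℝ 𝓓(Ω, ℝ)).symm u)‖ ≤
      C * ‖testToFracSobolevZeroₗ s Ω u‖ := by
    refine ⟨1, fun u => ?_⟩
    rw [one_mul]
    refine (norm_testToHomogeneous s u).le.trans ?_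
    refine le_trans ?_ (norm_testToFracSobolevZero s u).ge
    exact le_add_of_nonneg_left (norm_nonneg _)
  exact ⟨(LinearEquiv.refl ℝ 𝓓(Ω, ℝ)).extend (testToHomogeneousₗ s Ω)
    (testToFracSobolevZeroₗ s Ω) (denseRange_testToHomogeneous s) h1
    (denseRange_testToFracSobolevZero s) h2, fun u => LinearEquiv.extend_eq _ _ _ _ _ _ _ u⟩

/-- An identification of the two spaces that is continuous in one direction is continuous in both
by the open mapping theorem, and gives a Poincaré inequality on `C_c^∞(Ω)`. -/
theorem exists_poincare_of_equiv (e : HomogeneousSobolev s Ω ≃ₗ[ℝ] fracSobolevZero s Ω)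
    (he : Continuous e ∨ Continuous e.symm)
    (h : ∀ u : 𝓓(Ω, ℝ), e (testToHomogeneous s u) = testToFracSobolevZero s u) :
    ∃ C : ℝ, ∀ u : 𝓓(Ω, ℝ),
      ‖(memLp_testFunction u).toLp u‖ ≤ C * (gagliardoENorm s u).toReal := by
  have hc : Continuous e := by
    rcases he with he | he
    · exact he
    · exact (e.symm.toContinuousLinearEquivOfContinuous he).symm.continuous
  let T : HomogeneousSobolev s Ω →L[ℝ] fracSobolevZero s Ω := ⟨e.toLinearMap, hc⟩
  refine ⟨‖T‖, fun u => ?_⟩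
  have h1 := T.le_opNorm (testToHomogeneous s u)
  rw [norm_testToHomogeneous, show T (testToHomogeneous s u) = testToFracSobolevZero s u from h u,
    norm_testToFracSobolevZero] at h1
  linarith [ENNReal.toReal_nonneg (a := gagliardoENorm s u)]

end Identification

theorem norm_toLp_sq {Ω : Opens Plane} (u : 𝓓(Ω, ℝ)) :
    ENNReal.ofReal (‖(memLp_testFunction u).toLp u‖ ^ 2) = ∫⁻ x, ENNReal.ofReal (u x ^ 2) := by
  rw [Lp.norm_toLp, ENNReal.ofReal_pow ENNReal.toReal_nonneg,
    ENNReal.ofReal_toReal (memLp_testFunction u).eLpNorm_ne_top,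
    eLpNorm_eq_lintegral_rpow_enorm_toReal (by norm_num) (by norm_num), ← ENNReal.rpow_natCast,
    ← ENNReal.rpow_mul]
  simp only [ENNReal.toReal_ofNat, Nat.cast_ofNat, one_div, ENNReal.rpow_ofNat]
  rw [inv_mul_cancel₀ two_ne_zero, ENNReal.rpow_one]
  refine lintegral_congr fun x => ?_
  rw [Real.enorm_eq_ofReal_abs, ← ENNReal.ofReal_pow (abs_nonneg _), sq_abs]

theorem norm_toLp_le_of_lintegral_le (s : Ioo (0 : ℝ) 1) {Ω : Opens Plane} (u : 𝓓(Ω, ℝ))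
    {C : ℝ≥0∞} (hC : C ≠ ∞)
    (h : ∫⁻ x, ENNReal.ofReal (u x ^ 2) ≤ C * ∫⁻ q, gagliardoKernel s u q) :
    ‖(memLp_testFunction u).toLp u‖ ≤ √C.toReal * (gagliardoENorm s u).toReal := by
  refine abs_le_of_sq_le_sq' ?_ (by positivity) |>.2
  rw [← norm_toLp_sq, ← gagliardoENorm_sq] at h
  have hfin := gagliardoENorm_testFunction_lt_top s u
  have h1 := (ENNReal.ofReal_le_iff_le_toReal
    (ENNReal.mul_ne_top hC (ENNReal.pow_ne_top hfin.ne))).1 h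
  rwa [ENNReal.toReal_mul, ENNReal.toReal_pow, ← Real.sq_sqrt (ENNReal.toReal_nonneg (a := C)),
    ← mul_pow] at h1

/-! ### The seminorm of bounded Lipschitz functions -/

theorem lintegral_min_sq_div_lt_top (s : Ioo (0 : ℝ) 1) :
    ∫⁻ h : Plane, ENNReal.ofReal (min (‖h‖ ^ 2) 4 / ‖h‖ ^ (2 + 2 * (s : ℝ))) < ∞ := by
  obtain ⟨s, hs0, hs1⟩ := s
  simp only
  set f : ℝ → ℝ := fun r => min (r ^ 2) 4 / r ^ (2 + 2 * s) with hf
  have hfm : Measurable f := by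
    rw [hf]; fun_prop
  have hf0 : ∀ r, 0 < r → 0 ≤ f r := fun r hr => by rw [hf]; positivity
  have hint : Integrable (fun h : Plane => f ‖h‖) volume := by
    rw [integrable_fun_norm_addHaar]
    have hdim : Module.finrank ℝ Plane - 1 = 1 := by simp
    rw [hdim, ← Ioc_union_Ioi_eq_Ioi (zero_le_one (α := ℝ))]
    refine IntegrableOn.union ?_ ?_
    · have h1 : IntegrableOn (fun r : ℝ => r ^ (1 - 2 * s)) (Ioc 0 1) := by
        have := (intervalIntegral.intervalIntegrable_rpow' (a := 0) (b := 1)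
          (r := 1 - 2 * s) (by linarith))
        rwa [intervalIntegrable_iff_integrableOn_Ioc_of_le zero_le_one] at this
      refine Integrable.mono' h1 (by fun_prop) ?_
      filter_upwards [ae_restrict_mem measurableSet_Ioc] with r hr
      have hr0 : 0 < r := hr.1
      rw [smul_eq_mul, Real.norm_of_nonneg (mul_nonneg (by positivity) (hf0 r hr0))]
      have e : r ^ (1 - 2 * s) = r ^ 1 * (r ^ 2 / r ^ (2 + 2 * s)) := by
        rw [show 1 - 2 * s = ((3 : ℕ) : ℝ) - (2 + 2 * s) by push_cast; ring, Real.rpow_sub hr0,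
          Real.rpow_natCast]
        ring
      rw [e]
      refine mul_le_mul_of_nonneg_left ?_ (by positivity)
      exact div_le_div_of_nonneg_right (min_le_left _ _) (by positivity)
    · have h1 : IntegrableOn (fun r : ℝ => 4 * r ^ (-1 - 2 * s)) (Ioi 1) :=
        (integrableOn_Ioi_rpow_of_lt (by linarith) one_pos).const_mul _
      refine Integrable.mono' h1 (by fun_prop) ?_
      filter_upwards [ae_restrict_mem measurableSet_Ioi] with r hr
      have hr0 : 0 < r := lt_trans one_pos hr
      rw [smul_eq_mul, Real.norm_of_nonneg (mul_nonneg (by positivity) (hf0 r hr0))]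
      have e : 4 * r ^ (-1 - 2 * s) = r ^ 1 * (4 / r ^ (2 + 2 * s)) := by
        rw [show -1 - 2 * s = 1 - (2 + 2 * s) by ring, Real.rpow_sub hr0, Real.rpow_one]
        ring
      rw [e]
      refine mul_le_mul_of_nonneg_left ?_ (by positivity)
      exact div_le_div_of_nonneg_right (min_le_right _ _) (by positivity)
  exact hint.lintegral_lt_top

theorem lintegral_inv_smul {ε : ℝ} (hε : 0 < ε) {g : Plane → ℝ≥0∞} (hg : Measurable g) :
    ∫⁻ h, g (ε⁻¹ • h) = ENNReal.ofReal (ε ^ 2) * ∫⁻ h, g h := by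
  have h1 := Measure.map_addHaar_smul (volume : Measure Plane) (r := ε⁻¹) (by positivity)
  rw [← lintegral_map hg (by fun_prop), h1, lintegral_smul_measure]
  simp [abs_of_pos hε]

/-- A function bounded by `M`, with Lipschitz constant `M / ε` and supported in `K`, has energy at
most of the order of `M² ε ^ (-2 s) |K|`. -/
theorem exists_lintegral_gagliardoKernel_le (s : Ioo (0 : ℝ) 1) :
    ∃ C : ℝ≥0∞, C ≠ ∞ ∧ ∀ (u : Plane → ℝ) (M ε : ℝ) (K : Set Plane), 0 ≤ M → 0 < ε →
      MeasurableSet K → (∀ x, |u x| ≤ M) → (∀ x y, |u x - u y| ≤ M / ε * ‖x - y‖) →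
      (∀ x ∉ K, u x = 0) →
      ∫⁻ q, gagliardoKernel s u q ≤ C * ENNReal.ofReal (M ^ 2 * ε ^ (-2 * (s : ℝ))) * volume K := by
  set g : Plane → ℝ≥0∞ := fun h =>
    ENNReal.ofReal (min (‖h‖ ^ 2) 4 / ‖h‖ ^ (2 + 2 * (s : ℝ))) with hg
  have hgm : Measurable g := by
    rw [hg]; fun_prop
  refine ⟨2 * ∫⁻ h, g h, ENNReal.mul_ne_top (by simp) (lintegral_min_sq_div_lt_top s).ne, ?_⟩
  intro u M ε K hM hε hK hb hL h0
  set c : ℝ≥0∞ := ENNReal.ofReal (M ^ 2 * ε ^ (-2 - 2 * (s : ℝ))) with hc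
  have hpt : ∀ x y, gagliardoKernel s u (x, y) ≤ c * g (ε⁻¹ • (x - y)) := by
    intro x y
    rw [gagliardoKernel, hc, hg, ← ENNReal.ofReal_mul (by positivity)]
    refine ENNReal.ofReal_le_ofReal ?_
    simp only
    have e1 : ‖ε⁻¹ • (x - y)‖ = ‖x - y‖ / ε := by
      rw [norm_smul, norm_inv, Real.norm_of_nonneg hε.le, inv_mul_eq_div]
    rw [e1, Real.div_rpow (norm_nonneg _) hε.le,
      show -2 - 2 * (s : ℝ) = -(2 + 2 * (s : ℝ)) by ring, Real.rpow_neg hε.le]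
    have e2 : M ^ 2 * (ε ^ (2 + 2 * (s : ℝ)))⁻¹ * (min ((‖x - y‖ / ε) ^ 2) 4 /
        (‖x - y‖ ^ (2 + 2 * (s : ℝ)) / ε ^ (2 + 2 * (s : ℝ)))) =
        M ^ 2 * min ((‖x - y‖ / ε) ^ 2) 4 / ‖x - y‖ ^ (2 + 2 * (s : ℝ)) := by
      have : ε ^ (2 + 2 * (s : ℝ)) ≠ 0 := by positivity
      field_simp
    rw [e2]
    refine div_le_div_of_nonneg_right ?_ (by positivity)
    rw [mul_min_of_nonneg _ _ (by positivity)]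
    refine le_min ?_ ?_
    · calc |u x - u y| ^ 2 ≤ (M / ε * ‖x - y‖) ^ 2 := by gcongr; exact hL x y
        _ = _ := by ring
    · calc |u x - u y| ^ 2 ≤ (M + M) ^ 2 := by
            gcongr
            exact (abs_sub _ _).trans (add_le_add (hb x) (hb y))
        _ = _ := by ring
  have hi : Measurable (K.indicator (1 : Plane → ℝ≥0∞)) := measurable_one.indicator hK
  have hint : ∫⁻ h, c * g (ε⁻¹ • h) =
      ENNReal.ofReal (M ^ 2 * ε ^ (-2 * (s : ℝ))) * ∫⁻ h, g h := by
    rw [lintegral_const_mul _ (by fun_prop), lintegral_inv_smul hε hgm, ← mul_assoc, hc,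
      ← ENNReal.ofReal_mul (by positivity), mul_assoc, ← Real.rpow_natCast ε 2,
      ← Real.rpow_add hε]
    congr 4
    push_cast
    ring
  set g' : Plane → ℝ≥0∞ := fun h => c * g (ε⁻¹ • h) with hg'
  have hg'm : Measurable g' := by fun_prop
  calc ∫⁻ q, gagliardoKernel s u q
      ≤ ∫⁻ q : Plane × Plane, (K.indicator 1 q.1 * g' (q.1 - q.2)
          + K.indicator 1 q.2 * g' (q.1 - q.2)) := by
        refine lintegral_mono fun q => ?_
        have hb := hpt q.1 q.2
        by_cases h1 : q.1 ∈ K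
        · rw [indicator_of_mem h1]
          simpa using le_add_right hb
        by_cases h2 : q.2 ∈ K
        · rw [indicator_of_mem h2]
          simpa using le_add_left hb
        · simp [gagliardoKernel, h0 _ h1, h0 _ h2]
    _ = (∫⁻ q : Plane × Plane, K.indicator 1 q.1 * g' (q.1 - q.2))
          + ∫⁻ q : Plane × Plane, K.indicator 1 q.2 * g' (q.1 - q.2) :=
        lintegral_add_left (by fun_prop) _
    _ = volume K * (∫⁻ h, g' h) + volume K * ∫⁻ h, g' h := by
        congr 1
        · rw [Measure.volume_eq_prod, lintegral_prod _ (by fun_prop)]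
          simp only
          have : ∀ x : Plane, ∫⁻ y, K.indicator 1 x * g' (x - y) =
              K.indicator 1 x * ∫⁻ h, g' h := fun x => by
            rw [lintegral_const_mul _ (by fun_prop), lintegral_sub_left_eq_self]
          simp_rw [this]
          rw [lintegral_mul_const _ hi, lintegral_indicator_one hK]
        · rw [Measure.volume_eq_prod, lintegral_prod_symm _ (by fun_prop)]
          simp only
          have : ∀ y : Plane, ∫⁻ x, K.indicator 1 y * g' (x - y) =
              K.indicator 1 y * ∫⁻ h, g' h := fun y => by
            rw [lintegral_const_mul _ (by fun_prop), lintegral_sub_right_eq_self]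
          simp_rw [this]
          rw [lintegral_mul_const _ hi, lintegral_indicator_one hK]
    _ = _ := by
        rw [hint]
        ring

/-! ### Approximation by functions vanishing on a small set -/

/-- A bounded sequence in `L²` that is almost everywhere eventually zero converges weakly to
zero. -/
theorem tendsto_inner_zero_of_ae_eventually_eq_zero {α : Type*} [MeasurableSpace α]
    {μ : Measure α} (f : Lp ℝ 2 μ) {g : ℕ → Lp ℝ 2 μ} {B : ℝ} (hB : ∀ n, ‖g n‖ ≤ B)
    (hg : ∀ᵐ x ∂μ, ∀ᶠ n in Filter.atTop, g n x = 0) :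
    Filter.Tendsto (fun n => inner ℝ f (g n)) Filter.atTop (nhds 0) := by
  have hS : ∀ n, MeasurableSet {x | g n x ≠ 0} := fun n =>
    (Lp.stronglyMeasurable (g n)).measurable (measurableSet_singleton 0).compl
  set F : ℕ → Lp ℝ 2 μ := fun n => ((Lp.memLp f).indicator (hS n)).toLp _ with hF
  have hinner : ∀ n, inner ℝ f (g n) = inner ℝ (F n) (g n) := fun n => by
    rw [L2.inner_def, L2.inner_def]
    refine integral_congr_ae ?_
    filter_upwards [((Lp.memLp f).indicator (hS n)).coeFn_toLp] with x hx
    rw [hF, hx]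
    by_cases h0 : g n x = 0
    · rw [h0, inner_zero_right, inner_zero_right]
    · rw [indicator_of_mem (by exact h0)]
  have hnorm : Filter.Tendsto (fun n => ∫⁻ x, ‖{x | g n x ≠ 0}.indicator f x‖ₑ ^ (2 : ℝ) ∂μ)
      Filter.atTop (nhds 0) := by
    have hfin : ∫⁻ x, ‖f x‖ₑ ^ (2 : ℝ) ∂μ ≠ ∞ := by
      have := (lintegral_rpow_enorm_lt_top_of_eLpNorm_lt_top (by norm_num) (by norm_num)
        (Lp.eLpNorm_lt_top f)).ne
      simpa using this
    have hfm : Measurable f := (Lp.stronglyMeasurable f).measurable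
    rw [← lintegral_zero (μ := μ)]
    refine tendsto_lintegral_of_dominated_convergence (fun x => ‖f x‖ₑ ^ (2 : ℝ)) (fun n => ?_)
      (fun n => Filter.Eventually.of_forall fun x => ?_) hfin ?_
    · exact ((hfm.indicator (hS n)).enorm).pow_const _
    · exact ENNReal.rpow_le_rpow (enorm_indicator_le_enorm_self _ _) (by norm_num)
    · filter_upwards [hg] with x hx
      refine tendsto_const_nhds.congr' ?_
      filter_upwards [hx] with n hn
      rw [indicator_of_notMem (by simpa using hn)]
      simp
  have hF0 : Filter.Tendsto (fun n => ‖F n‖) Filter.atTop (nhds 0) := by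
    have h1 : ∀ n, ‖F n‖ =
        ((∫⁻ x, ‖{x | g n x ≠ 0}.indicator f x‖ₑ ^ (2 : ℝ) ∂μ) ^ (1 / 2 : ℝ)).toReal := fun n => by
      rw [hF, Lp.norm_toLp, eLpNorm_eq_lintegral_rpow_enorm_toReal (by norm_num) (by norm_num)]
      simp
    simp only [h1]
    rw [← ENNReal.toReal_zero]
    refine (ENNReal.tendsto_toReal ENNReal.zero_ne_top).comp ?_
    have := hnorm.ennrpow_const (1 / 2)
    rwa [ENNReal.zero_rpow_of_pos (by norm_num)] at this
  rw [tendsto_zero_iff_abs_tendsto_zero]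
  refine squeeze_zero (fun _ => abs_nonneg _) (fun n => ?_)
    (by simpa using hF0.mul_const B)
  simp only [Function.comp_apply]
  rw [hinner]
  exact (abs_real_inner_le_norm _ _).trans (by gcongr; exact hB n)

section Graph

variable (s : Ioo (0 : ℝ) 1) {Ω : Opens Plane}

/-- The difference quotient whose `L²` norm on `ℝ² × ℝ²` is the Gagliardo-Slobodeckii seminorm. -/
noncomputable def fracQuotient (u : Plane → ℝ) (q : Plane × Plane) : ℝ :=
  (u q.1 - u q.2) / ‖q.1 - q.2‖ ^ (1 + (s : ℝ))

theorem memLp_fracQuotient (u : 𝓓(Ω, ℝ)) : MemLp (fracQuotient s u) 2 volume :=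
  ⟨aestronglyMeasurable_gagliardo s u.continuous.aestronglyMeasurable, by
    have := gagliardoENorm_testFunction_lt_top s u
    rwa [gagliardoENorm_eq_eLpNorm] at this⟩

/-- The pair of a test function and its difference quotient, in the Hilbert space
`L²(ℝ²) × L²(ℝ² × ℝ²)`. -/
noncomputable def testGraph (u : 𝓓(Ω, ℝ)) :
    WithLp 2 (Lp ℝ 2 (volume : Measure Plane) × Lp ℝ 2 (volume : Measure (Plane × Plane))) :=
  WithLp.toLp 2 ((memLp_testFunction u).toLp u, (memLp_fracQuotient s u).toLp _)

theorem norm_fst_testGraph (u : 𝓓(Ω, ℝ)) :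
    ‖(testGraph s u).fst‖ = ‖(memLp_testFunction u).toLp u‖ := rfl

theorem norm_snd_testGraph (u : 𝓓(Ω, ℝ)) :
    ‖(testGraph s u).snd‖ = (gagliardoENorm s u).toReal := by
  rw [gagliardoENorm_eq_eLpNorm]
  exact Lp.norm_toLp _ (memLp_fracQuotient s u)

variable (Ω) in
/-- The graphs of the test functions in `Ω`. -/
noncomputable def testGraphSubmodule : Submodule ℝ
    (WithLp 2 (Lp ℝ 2 (volume : Measure Plane) × Lp ℝ 2 (volume : Measure (Plane × Plane)))) where
  carrier := range (testGraph s (Ω := Ω))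
  add_mem' := by
    rintro _ _ ⟨u, rfl⟩ ⟨v, rfl⟩
    refine ⟨u + v, ?_⟩
    refine (WithLp.ofLp_injective 2) (Prod.ext rfl ?_)
    change (memLp_fracQuotient s (u + v)).toLp _ =
      (memLp_fracQuotient s u).toLp _ + (memLp_fracQuotient s v).toLp _
    rw [← MemLp.toLp_add]
    congr 1
    funext q
    change (u q.1 + v q.1 - (u q.2 + v q.2)) / _ = (u q.1 - u q.2) / _ + (v q.1 - v q.2) / _
    ring
  zero_mem' := by
    refine ⟨0, ?_⟩
    refine (WithLp.ofLp_injective 2) (Prod.ext rfl ?_)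
    change (memLp_fracQuotient s (0 : 𝓓(Ω, ℝ))).toLp _ = 0
    rw [Lp.eq_zero_iff_ae_eq_zero]
    filter_upwards [(memLp_fracQuotient s (0 : 𝓓(Ω, ℝ))).coeFn_toLp] with q hq
    rw [hq]
    simp [fracQuotient]
  smul_mem' := by
    rintro c _ ⟨u, rfl⟩
    refine ⟨c • u, ?_⟩
    refine (WithLp.ofLp_injective 2) (Prod.ext rfl ?_)
    change (memLp_fracQuotient s (c • u)).toLp _ = c • (memLp_fracQuotient s u).toLp _
    rw [← MemLp.toLp_const_smul]
    congr 1
    funext q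
    change (c * u q.1 - c * u q.2) / _ = c * ((u q.1 - u q.2) / _)
    ring

theorem sub_mem_testGraphSubmodule {φ v : 𝓓((⊤ : Opens Plane), ℝ)}
    (h : tsupport (fun x => φ x - v x) ⊆ Ω) :
    testGraph s φ - testGraph s v ∈ testGraphSubmodule s Ω := by
  have hc : HasCompactSupport fun x => φ x - v x := by
    have := φ.hasCompactSupport.add v.hasCompactSupport.neg
    simpa [sub_eq_add_neg] using! this
  let w : 𝓓(Ω, ℝ) := ⟨fun x => φ x - v x, φ.contDiff.sub v.contDiff, hc, h⟩
  refine ⟨w, ?_⟩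
  refine (WithLp.ofLp_injective 2) (Prod.ext rfl ?_)
  change (memLp_fracQuotient s w).toLp _ =
    (memLp_fracQuotient s φ).toLp _ - (memLp_fracQuotient s v).toLp _
  rw [← MemLp.toLp_sub]
  congr 1
  funext q
  change (φ q.1 - v q.1 - (φ q.2 - v q.2)) / _ = (φ q.1 - φ q.2) / _ - (v q.1 - v q.2) / _
  ring

/-- A Poincaré inequality on `C_c^∞(Ω)` persists for a test function `φ` of the plane that can be
cut off to `Ω` at bounded cost: the discarded parts `v n` converge weakly to zero, so that the
graph of `φ` is in the closed linear span of those of the functions `φ - v n`. -/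
theorem poincare_of_tsupport_sub_subset {C : ℝ}
    (hC : ∀ u : 𝓓(Ω, ℝ), ‖(memLp_testFunction u).toLp u‖ ≤ C * (gagliardoENorm s u).toReal)
    {φ : 𝓓((⊤ : Opens Plane), ℝ)} {v : ℕ → 𝓓((⊤ : Opens Plane), ℝ)} {B : ℝ}
    (hsub : ∀ n, tsupport (fun x => φ x - v n x) ⊆ Ω)
    (hv : ∀ᵐ x, ∀ᶠ n in Filter.atTop, v n x = 0)
    (hB : ∀ n, ‖(memLp_testFunction (v n)).toLp (v n)‖ ≤ B)
    (hB' : ∀ n, (gagliardoENorm s (v n)).toReal ≤ B) :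
    ‖(memLp_testFunction φ).toLp φ‖ ≤ C * (gagliardoENorm s φ).toReal := by
  have hmem : testGraph s φ ∈ (testGraphSubmodule s Ω).topologicalClosure := by
    rw [← Submodule.orthogonal_orthogonal_eq_closure, Submodule.mem_orthogonal]
    intro ψ hψ
    have heq : ∀ n, inner ℝ ψ (testGraph s φ) = inner ℝ ψ (testGraph s (v n)) := fun n => by
      rw [← sub_eq_zero, ← inner_sub_right, real_inner_comm]
      exact (Submodule.mem_orthogonal _ _).1 hψ _ (sub_mem_testGraphSubmodule s (hsub n))
    have h1 : Filter.Tendsto (fun n => inner ℝ ψ.fst (testGraph s (v n)).fst) Filter.atTop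
        (nhds 0) := by
      refine tendsto_inner_zero_of_ae_eventually_eq_zero ψ.fst hB ?_
      filter_upwards [hv, ae_all_iff.2 fun n => (memLp_testFunction (v n)).coeFn_toLp]
        with x hx hx'
      filter_upwards [hx] with n hn
      exact (hx' n).trans hn
    have h2 : Filter.Tendsto (fun n => inner ℝ ψ.snd (testGraph s (v n)).snd) Filter.atTop
        (nhds 0) := by
      refine tendsto_inner_zero_of_ae_eventually_eq_zero ψ.snd
        (fun n => (norm_snd_testGraph s (v n)).le.trans (hB' n)) ?_
      have hv1 := (Measure.quasiMeasurePreserving_fst (μ := (volume : Measure Plane))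
        (ν := (volume : Measure Plane))).ae hv
      have hv2 := (Measure.quasiMeasurePreserving_snd (μ := (volume : Measure Plane))
        (ν := (volume : Measure Plane))).ae hv
      filter_upwards [hv1, hv2, ae_all_iff.2 fun n => (memLp_fracQuotient s (v n)).coeFn_toLp]
        with q hq1 hq2 hq
      filter_upwards [hq1, hq2] with n hn1 hn2
      refine (hq n).trans ?_
      rw [fracQuotient, hn1, hn2]
      simp
    have h3 := h1.add h2
    rw [add_zero] at h3
    refine tendsto_nhds_unique (tendsto_const_nhds (x := inner ℝ ψ (testGraph s φ))) (h3.congr ?_)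
    intro n
    rw [heq n]
    rfl
  have hclosed : IsClosed {a : WithLp 2 (Lp ℝ 2 (volume : Measure Plane) ×
      Lp ℝ 2 (volume : Measure (Plane × Plane))) | ‖a.fst‖ ≤ C * ‖a.snd‖} :=
    isClosed_le (by fun_prop) (by fun_prop)
  have hle := closure_minimal (s := (testGraphSubmodule s Ω : Set _)) (by
    rintro _ ⟨u, rfl⟩
    rw [mem_ofPred_eq, norm_fst_testGraph, norm_snd_testGraph]
    exact hC u) hclosed hmem
  rwa [mem_ofPred_eq, norm_fst_testGraph, norm_snd_testGraph] at hle

end Graph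

/-! ### Cutoff functions for the comb -/

/-- A smooth function on the plane, equal to `1` for `‖x‖ ≤ R` and to `0` for `2 R ≤ ‖x‖`. -/
noncomputable def diskCutoff (R : ℝ) (x : Plane) : ℝ :=
  (⟨1, 2, one_pos, one_lt_two⟩ : ContDiffBump (0 : Plane)) (R⁻¹ • x)

/-- A smooth function on the plane, equal to `1` near the horizontal lines of integer height and
to `0` at the points with `2 ε ≤ |sin (π x₁)|`, that is, outside strips of width of order `ε` around
these lines. -/
noncomputable def lineCutoff (ε : ℝ) (x : Plane) : ℝ :=
  (⟨1, 2, one_pos, one_lt_two⟩ : ContDiffBump (0 : ℝ)) (ε⁻¹ * Real.sin (Real.pi * x 1))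

theorem contDiff_diskCutoff (R : ℝ) {n : ℕ∞} : ContDiff ℝ n (diskCutoff R) :=
  (ContDiffBump.contDiff _).comp (by fun_prop)

theorem contDiff_lineCutoff (ε : ℝ) {n : ℕ∞} : ContDiff ℝ n (lineCutoff ε) :=
  (ContDiffBump.contDiff _).comp (by fun_prop)

theorem abs_diskCutoff_le_one (R : ℝ) (x : Plane) : |diskCutoff R x| ≤ 1 := by
  rw [diskCutoff, abs_of_nonneg (ContDiffBump.nonneg _)]
  exact ContDiffBump.le_one _

theorem abs_lineCutoff_le_one (ε : ℝ) (x : Plane) : |lineCutoff ε x| ≤ 1 := by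
  rw [lineCutoff, abs_of_nonneg (ContDiffBump.nonneg _)]
  exact ContDiffBump.le_one _

theorem diskCutoff_eq_one {R : ℝ} (hR : 0 < R) {x : Plane} (hx : ‖x‖ ≤ R) :
    diskCutoff R x = 1 := by
  refine ContDiffBump.one_of_mem_closedBall _ ?_
  rw [mem_closedBall_zero_iff, norm_smul, norm_inv, Real.norm_of_nonneg hR.le, inv_mul_le_iff₀ hR]
  simpa using hx

theorem diskCutoff_eq_zero {R : ℝ} (hR : 0 < R) {x : Plane} (hx : 2 * R ≤ ‖x‖) :
    diskCutoff R x = 0 := by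
  refine ContDiffBump.zero_of_le_dist _ ?_
  rw [dist_zero_right, norm_smul, norm_inv, Real.norm_of_nonneg hR.le, le_inv_mul_iff₀ hR]
  linarith

theorem lineCutoff_eq_one {ε : ℝ} (hε : 0 < ε) {x : Plane}
    (hx : |Real.sin (Real.pi * x 1)| ≤ ε) : lineCutoff ε x = 1 := by
  refine ContDiffBump.one_of_mem_closedBall _ ?_
  rw [mem_closedBall_zero_iff, norm_mul, norm_inv, Real.norm_of_nonneg hε.le, inv_mul_le_iff₀ hε,
    Real.norm_eq_abs]
  simpa using hx

theorem lineCutoff_eq_zero {ε : ℝ} (hε : 0 < ε) {x : Plane}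
    (hx : 2 * ε ≤ |Real.sin (Real.pi * x 1)|) : lineCutoff ε x = 0 := by
  refine ContDiffBump.zero_of_le_dist _ ?_
  rw [dist_zero_right, norm_mul, norm_inv, Real.norm_of_nonneg hε.le, le_inv_mul_iff₀ hε,
    Real.norm_eq_abs]
  linarith

theorem exists_lipschitz_contDiffBump {E : Type*} [NormedAddCommGroup E] [InnerProductSpace ℝ E]
    [FiniteDimensional ℝ E] (f : ContDiffBump (0 : E)) :
    ∃ L : ℝ, 0 ≤ L ∧ ∀ x y, |f x - f y| ≤ L * ‖x - y‖ := by
  obtain ⟨L, hL⟩ := (f.contDiff (n := 1)).lipschitzWith_of_hasCompactSupport f.hasCompactSupport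
    (by norm_num)
  refine ⟨L, L.2, fun x y => ?_⟩
  have := hL.dist_le_mul x y
  rwa [Real.dist_eq, dist_eq_norm] at this

theorem exists_lipschitz_diskCutoff :
    ∃ L : ℝ, 0 ≤ L ∧ ∀ R > 0, ∀ x y, |diskCutoff R x - diskCutoff R y| ≤ L / R * ‖x - y‖ := by
  obtain ⟨L, hL, h⟩ := exists_lipschitz_contDiffBump
    (⟨1, 2, one_pos, one_lt_two⟩ : ContDiffBump (0 : Plane))
  refine ⟨L, hL, fun R hR x y => (h _ _).trans (le_of_eq ?_)⟩
  rw [← smul_sub, norm_smul, norm_inv, Real.norm_of_nonneg hR.le]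
  ring

theorem exists_lipschitz_lineCutoff :
    ∃ L : ℝ, 0 ≤ L ∧ ∀ ε > 0, ∀ x y, |lineCutoff ε x - lineCutoff ε y| ≤ L / ε * ‖x - y‖ := by
  obtain ⟨L, hL, h⟩ := exists_lipschitz_contDiffBump
    (⟨1, 2, one_pos, one_lt_two⟩ : ContDiffBump (0 : ℝ))
  refine ⟨L * Real.pi, by positivity, fun ε hε x y => (h _ _).trans ?_⟩
  rw [← mul_sub, norm_mul, norm_inv, Real.norm_of_nonneg hε.le, Real.norm_eq_abs]
  have h1 := Real.abs_sin_sub_sin_le (Real.pi * x 1) (Real.pi * y 1)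
  rw [← mul_sub, abs_mul, abs_of_pos Real.pi_pos] at h1
  have h2 : |x 1 - y 1| ≤ ‖x - y‖ := PiLp.norm_apply_le (x - y) 1
  calc L * (ε⁻¹ * |Real.sin (Real.pi * x 1) - Real.sin (Real.pi * y 1)|)
      ≤ L * (ε⁻¹ * (Real.pi * ‖x - y‖)) := by
        gcongr
        exact h1.trans (by gcongr)
    _ = _ := by ring

/-- A common constant for the Lipschitz bounds of the cutoff functions and of their products. -/
theorem exists_bound_cutoff :
    ∃ M : ℝ, 1 ≤ M ∧
      (∀ R > 0, ∀ x y, |diskCutoff R x - diskCutoff R y| ≤ M / R * ‖x - y‖) ∧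
      ∀ R ε : ℝ, 0 < ε → ε ≤ R → ∀ x y, |diskCutoff R x * lineCutoff ε x -
        diskCutoff R y * lineCutoff ε y| ≤ M / ε * ‖x - y‖ := by
  obtain ⟨L₁, hL₁, h₁⟩ := exists_lipschitz_diskCutoff
  obtain ⟨L₂, hL₂, h₂⟩ := exists_lipschitz_lineCutoff
  refine ⟨1 + L₁ + L₂, by linarith, fun R hR x y => (h₁ R hR x y).trans ?_, ?_⟩
  · gcongr
    linarith
  intro R ε hε hεR x y
  have e : diskCutoff R x * lineCutoff ε x - diskCutoff R y * lineCutoff ε y =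
      (diskCutoff R x - diskCutoff R y) * lineCutoff ε x +
        diskCutoff R y * (lineCutoff ε x - lineCutoff ε y) := by ring
  rw [e]
  refine (abs_add_le _ _).trans ?_
  rw [abs_mul, abs_mul]
  have h3 : |diskCutoff R x - diskCutoff R y| ≤ L₁ / ε * ‖x - y‖ :=
    (h₁ R (hε.trans_le hεR) x y).trans (by gcongr)
  calc |diskCutoff R x - diskCutoff R y| * |lineCutoff ε x| +
        |diskCutoff R y| * |lineCutoff ε x - lineCutoff ε y|
      ≤ L₁ / ε * ‖x - y‖ * 1 + 1 * (L₂ / ε * ‖x - y‖) := by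
        gcongr
        · exact abs_lineCutoff_le_one _ _
        · exact abs_diskCutoff_le_one _ _
        · exact h₂ ε hε x y
    _ ≤ (1 + L₁ + L₂) / ε * ‖x - y‖ := by
        have : 0 ≤ 1 / ε * ‖x - y‖ := by positivity
        calc _ ≤ L₁ / ε * ‖x - y‖ * 1 + 1 * (L₂ / ε * ‖x - y‖) + 1 / ε * ‖x - y‖ := by linarith
          _ = _ := by ring

/-- The part of the disk of radius `2 R` where `lineCutoff ε` may be nonzero. -/
def stripSet (R ε : ℝ) : Set Plane := {x | ‖x‖ ≤ 2 * R ∧ |Real.sin (Real.pi * x 1)| ≤ 2 * ε}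

theorem measurableSet_stripSet (R ε : ℝ) : MeasurableSet (stripSet R ε) := by
  have h1 : IsClosed {x : Plane | ‖x‖ ≤ 2 * R} := isClosed_le (by fun_prop) (by fun_prop)
  have h2 : IsClosed {x : Plane | |Real.sin (Real.pi * x 1)| ≤ 2 * ε} :=
    isClosed_le (by fun_prop) (by fun_prop)
  exact (h1.inter h2).measurableSet

theorem abs_sub_round_le_abs_sin (t : ℝ) : 2 * |t - round t| ≤ |Real.sin (Real.pi * t)| := by
  have h1 := abs_sub_round t
  have h2 : |Real.sin (Real.pi * t)| = |Real.sin (Real.pi * (t - round t))| := by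
    rw [mul_sub, mul_comm Real.pi (round t : ℝ), Real.sin_sub_int_mul_pi, abs_mul]
    simp
  have h3 := Real.mul_abs_le_abs_sin (x := Real.pi * (t - round t)) (by
    rw [abs_mul, abs_of_pos Real.pi_pos]
    have := mul_le_mul_of_nonneg_left h1 Real.pi_pos.le
    linarith)
  rw [h2]
  refine le_trans (le_of_eq ?_) h3
  rw [abs_mul, abs_of_pos Real.pi_pos]
  have := Real.pi_ne_zero
  field_simp

theorem exists_volume_stripSet_le (R : ℝ) :
    ∃ C : ℝ≥0∞, C ≠ ∞ ∧ ∀ ε, 0 < ε → volume (stripSet R ε) ≤ C * ENNReal.ofReal ε := by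
  set N : ℤ := ⌈2 * R + 1⌉ with hN
  have hN' : 2 * R + 1 ≤ N := Int.le_ceil _
  refine ⟨ENNReal.ofReal (4 * R) * ((Finset.Icc (-N) N).card * 2), ENNReal.mul_ne_top
    ENNReal.ofReal_ne_top (ENNReal.mul_ne_top (by simp) (by simp)), fun ε hε => ?_⟩
  set S : Set ℝ := ⋃ m ∈ Finset.Icc (-N) N, Icc ((m : ℝ) - ε) (m + ε) with hS
  have hSm : MeasurableSet S :=
    Finset.measurableSet_biUnion _ fun m _ => measurableSet_Icc
  have hsub : stripSet R ε ⊆ (WithLp.ofLp : Plane → Fin 2 → ℝ) ⁻¹'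
      (univ.pi ![Icc (-(2 * R)) (2 * R), S]) := by
    rintro x ⟨h1, h2⟩
    have hx0 : |x 0| ≤ 2 * R := (PiLp.norm_apply_le x 0).trans h1
    have hx1 : |x 1| ≤ 2 * R := (PiLp.norm_apply_le x 1).trans h1
    have h3 := (abs_sub_round_le_abs_sin (x 1)).trans h2
    have h4 := abs_sub_round (x 1)
    rw [abs_le] at hx1 h4
    have h5 : |x 1 - round (x 1)| ≤ ε := by linarith
    rw [abs_le] at h5
    rw [mem_preimage, mem_univ_pi, Fin.forall_fin_two]
    refine ⟨abs_le.1 hx0, ?_⟩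
    simp only [Matrix.cons_val_one, Matrix.cons_val_fin_one, hS, mem_iUnion, exists_prop]
    refine ⟨round (x 1), Finset.mem_Icc.2 ⟨?_, ?_⟩, ?_⟩
    · have : (((-N : ℤ) : ℤ) : ℝ) ≤ (round (x 1) : ℝ) := by push_cast; linarith
      exact_mod_cast this
    · have : (round (x 1) : ℝ) ≤ ((N : ℤ) : ℝ) := by linarith
      exact_mod_cast this
    · constructor <;> linarith
  have hvS : volume S ≤ (Finset.Icc (-N) N).card * 2 * ENNReal.ofReal ε := by
    refine (measure_biUnion_finset_le _ _).trans ?_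
    have : ∀ m : ℤ, volume (Icc ((m : ℝ) - ε) (m + ε)) = 2 * ENNReal.ofReal ε := fun m => by
      rw [Real.volume_Icc, show (m : ℝ) + ε - (m - ε) = 2 * ε by ring,
        ENNReal.ofReal_mul (by norm_num)]
      simp
    simp only [this, Finset.sum_const, nsmul_eq_mul]
    rw [mul_assoc]
  refine (measure_mono hsub).trans ?_
  rw [(PiLp.volume_preserving_ofLp (Fin 2)).measure_preimage
    (MeasurableSet.univ_pi fun i => by
      fin_cases i
      · exact measurableSet_Icc
      · exact hSm).nullMeasurableSet, volume_pi_pi, Fin.prod_univ_two]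
  simp only [Matrix.cons_val_zero, Matrix.cons_val_one, Matrix.cons_val_fin_one]
  rw [Real.volume_Icc, show 2 * R - -(2 * R) = 4 * R by ring, mul_assoc]
  gcongr

/-- The points where this fails lie on the lines of integer height, which are negligible. -/
theorem ae_eventually_cutoff_eq_zero {R : ℝ} (hR : 0 < R) {ε : ℕ → ℝ} (hε : ∀ n, 0 < ε n)
    (hlim : Filter.Tendsto ε Filter.atTop (nhds 0)) :
    ∀ᵐ x, ∀ᶠ n in Filter.atTop, diskCutoff R x * lineCutoff (ε n) x = 0 := by
  obtain ⟨C, hC, hCε⟩ := exists_volume_stripSet_le R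
  have hnull : volume (⋂ n, stripSet R (ε n)) = 0 := by
    have h1 : Filter.Tendsto (fun n => C * ENNReal.ofReal (ε n)) Filter.atTop (nhds 0) := by
      have := ENNReal.Tendsto.const_mul (a := C) (ENNReal.tendsto_ofReal hlim) (Or.inr hC)
      simpa using this
    refine le_antisymm (ge_of_tendsto' h1 fun n => ?_) zero_le
    exact (measure_mono (iInter_subset _ n)).trans (hCε _ (hε n))
  filter_upwards [measure_eq_zero_iff_ae_notMem.1 hnull] with x hx
  rcases le_or_gt (2 * R) ‖x‖ with h | h
  · exact Filter.Eventually.of_forall fun n => by rw [diskCutoff_eq_zero hR h, zero_mul]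
  · obtain ⟨m, hm⟩ : ∃ m, x ∉ stripSet R (ε m) := by simpa using hx
    have hpos : 0 < |Real.sin (Real.pi * x 1)| := by
      by_contra! h0
      exact hm ⟨h.le, h0.trans (by linarith [hε m])⟩
    filter_upwards [hlim.eventually_lt_const (half_pos hpos)] with n hn
    rw [lineCutoff_eq_zero (hε n) (by linarith), mul_zero]

/-- The cutoff function to a disk as a test function. -/
noncomputable def diskTest {R : ℝ} (hR : 0 < R) : 𝓓((⊤ : Opens Plane), ℝ) :=
  ⟨diskCutoff R, contDiff_diskCutoff R,
    HasCompactSupport.intro (isCompact_closedBall (0 : Plane) (2 * R)) fun x hx =>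
      diskCutoff_eq_zero hR (by simpa using (not_le.1 (by simpa using hx)).le),
    subset_univ _⟩

/-- The part of the cutoff function to a disk that is close to the lines of integer height. -/
noncomputable def stripTest {R : ℝ} (hR : 0 < R) (ε : ℝ) : 𝓓((⊤ : Opens Plane), ℝ) :=
  ⟨fun x => diskCutoff R x * lineCutoff ε x, (contDiff_diskCutoff R).mul (contDiff_lineCutoff ε),
    (diskTest hR).hasCompactSupport.mul_right, subset_univ _⟩

theorem tsupport_sub_subset_comb {R : ℝ} (hR : 0 < R) {ε : ℝ} (hε : 0 < ε) :
    tsupport (fun x => diskTest hR x - stripTest hR ε x) ⊆ infiniteComplementComb := by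
  have hclosed : IsClosed {x : Plane | ε ≤ |Real.sin (Real.pi * x 1)|} :=
    isClosed_le (by fun_prop) (by fun_prop)
  refine (closure_minimal (fun x hx => ?_) hclosed).trans fun x hx hx' => ?_
  · by_contra h
    rw [mem_ofPred_eq, not_le] at h
    refine hx ?_
    change diskCutoff R x - diskCutoff R x * lineCutoff ε x = 0
    rw [lineCutoff_eq_one hε h.le, mul_one, sub_self]
  · obtain ⟨i, -, hi⟩ := mem_iUnion.1 hx'
    rw [mem_ofPred_eq, hi, mul_comm, Real.sin_int_mul_pi, abs_zero] at hx
    linarith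

/-! ### Failure of the Poincaré inequality in the comb -/

/-- For `s ≤ 1 / 2` lines are negligible for the Gagliardo-Slobodeckii seminorm: the energy
`ε ^ (1 - 2 s)` of a cutoff at distance `ε` stays bounded. -/
theorem poincare_diskTest_of_comb {s : Ioo (0 : ℝ) 1} (hs : (s : ℝ) ≤ 1 / 2) {C : ℝ}
    (hC : ∀ u : 𝓓(infiniteComplementComb, ℝ),
      ‖(memLp_testFunction u).toLp u‖ ≤ C * (gagliardoENorm s u).toReal) {R : ℝ} (hR : 1 ≤ R) :
    ‖(memLp_testFunction (diskTest (one_pos.trans_le hR))).toLp _‖ ≤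
      C * (gagliardoENorm s (diskTest (one_pos.trans_le hR))).toReal := by
  have hR0 : 0 < R := one_pos.trans_le hR
  obtain ⟨M, hM, -, hL⟩ := exists_bound_cutoff
  obtain ⟨D, hD, hE⟩ := exists_lintegral_gagliardoKernel_le s
  obtain ⟨A, hA, hvol⟩ := exists_volume_stripSet_le R
  set ε : ℕ → ℝ := fun n => 1 / ((n : ℝ) + 1) with hε
  have hε0 : ∀ n, 0 < ε n := fun n => by rw [hε]; positivity
  have hε1 : ∀ n, ε n ≤ 1 := fun n => by
    simp only [hε]
    rw [div_le_one (by positivity)]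
    linarith [Nat.cast_nonneg (α := ℝ) n]
  have hzero : ∀ n, ∀ x ∉ stripSet R (ε n), diskCutoff R x * lineCutoff (ε n) x = 0 := by
    intro n x hx
    rcases le_or_gt (2 * R) ‖x‖ with h | h
    · rw [diskCutoff_eq_zero hR0 h, zero_mul]
    · rw [lineCutoff_eq_zero (hε0 n), mul_zero]
      by_contra! h'
      exact hx ⟨h.le, h'.le⟩
  have habs : ∀ n x, |diskCutoff R x * lineCutoff (ε n) x| ≤ 1 := fun n x => by
    rw [abs_mul]
    exact mul_le_one₀ (abs_diskCutoff_le_one _ _) (abs_nonneg _) (abs_lineCutoff_le_one _ _)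
  have hgag : ∀ n, gagliardoENorm s (stripTest hR0 (ε n)) ^ 2 ≤
      D * ENNReal.ofReal (M ^ 2) * A := by
    intro n
    rw [gagliardoENorm_sq]
    refine (hE _ M (ε n) (stripSet R (ε n)) (by linarith) (hε0 n) (measurableSet_stripSet _ _)
      (fun x => (habs n x).trans hM) (hL R (ε n) (hε0 n) ((hε1 n).trans hR)) (hzero n)).trans ?_
    calc D * ENNReal.ofReal (M ^ 2 * ε n ^ (-2 * (s : ℝ))) * volume (stripSet R (ε n))
        ≤ D * ENNReal.ofReal (M ^ 2 * ε n ^ (-2 * (s : ℝ))) * (A * ENNReal.ofReal (ε n)) := by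
          gcongr
          exact hvol _ (hε0 n)
      _ = D * ENNReal.ofReal (M ^ 2) * A * ENNReal.ofReal (ε n ^ (-2 * (s : ℝ)) * ε n) := by
          rw [ENNReal.ofReal_mul (by positivity),
            ENNReal.ofReal_mul (Real.rpow_nonneg (hε0 n).le _)]
          ring
      _ ≤ D * ENNReal.ofReal (M ^ 2) * A * 1 := by
          gcongr
          rw [← Real.rpow_add_one (hε0 n).ne', ENNReal.ofReal_le_one]
          exact Real.rpow_le_one (hε0 n).le (hε1 n) (by linarith)
      _ = _ := mul_one _
  have hL2 : ∀ n, ENNReal.ofReal (‖(memLp_testFunction (stripTest hR0 (ε n))).toLp _‖ ^ 2) ≤ A := by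
    intro n
    rw [norm_toLp_sq]
    calc ∫⁻ x, ENNReal.ofReal ((stripTest hR0 (ε n) x) ^ 2)
        ≤ ∫⁻ x, (stripSet R (ε n)).indicator 1 x := by
          refine lintegral_mono fun x => ?_
          by_cases hx : x ∈ stripSet R (ε n)
          · rw [indicator_of_mem hx, Pi.one_apply, ENNReal.ofReal_le_one, sq_le_one_iff_abs_le_one]
            exact habs n x
          · change ENNReal.ofReal ((diskCutoff R x * lineCutoff (ε n) x) ^ 2) ≤ _
            simp [hzero n x hx]
      _ = volume (stripSet R (ε n)) := lintegral_indicator_one (measurableSet_stripSet _ _)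
      _ ≤ A * ENNReal.ofReal (ε n) := hvol _ (hε0 n)
      _ ≤ A * 1 := by
          gcongr
          exact ENNReal.ofReal_le_one.2 (hε1 n)
      _ = A := mul_one A
  set E : ℝ≥0∞ := D * ENNReal.ofReal (M ^ 2) * A with hEdef
  have hEtop : E ≠ ∞ := ENNReal.mul_ne_top (ENNReal.mul_ne_top hD ENNReal.ofReal_ne_top) hA
  refine poincare_of_tsupport_sub_subset s hC (v := fun n => stripTest hR0 (ε n))
    (B := max √A.toReal √E.toReal)
    (fun n => tsupport_sub_subset_comb hR0 (hε0 n))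
    (ae_eventually_cutoff_eq_zero hR0 hε0 tendsto_one_div_add_atTop_nhds_zero_nat) ?_ ?_
  · intro n
    refine le_max_of_le_left (Real.le_sqrt_of_sq_le ?_)
    exact (ENNReal.ofReal_le_iff_le_toReal hA).1 (hL2 n)
  · intro n
    refine le_max_of_le_right (Real.le_sqrt_of_sq_le ?_)
    rw [← ENNReal.toReal_pow]
    exact ENNReal.toReal_mono hEtop (hgag n)

theorem not_poincare_comb {s : Ioo (0 : ℝ) 1} (hs : (s : ℝ) ≤ 1 / 2) (C : ℝ) :
    ¬ ∀ u : 𝓓(infiniteComplementComb, ℝ),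
      ‖(memLp_testFunction u).toLp u‖ ≤ C * (gagliardoENorm s u).toReal := by
  intro hC
  obtain ⟨M, hM, hL, -⟩ := exists_bound_cutoff
  obtain ⟨D, hD, hE⟩ := exists_lintegral_gagliardoKernel_le s
  set a : ℝ := C ^ 2 * (D.toReal * M ^ 2 * 4) with ha
  -- The two sides scale like `R ^ 2` and `R ^ (2 - 2 s)`.
  have key : ∀ R : ℝ, 1 ≤ R → 1 ≤ a * R ^ (-2 * (s : ℝ)) := by
    intro R hR
    have hR0 : 0 < R := one_pos.trans_le hR
    have hP := poincare_diskTest_of_comb hs hC hR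
    set V : ℝ := (volume (Metric.closedBall (0 : Plane) 1)).toReal with hV
    have hV0 : 0 < V := ENNReal.toReal_pos (Metric.measure_closedBall_pos _ _ one_pos).ne'
      (isCompact_closedBall _ _).measure_lt_top.ne
    have hball : ∀ r : ℝ, 0 ≤ r → volume (Metric.closedBall (0 : Plane) r) =
        ENNReal.ofReal (r ^ 2 * V) := fun r hr => by
      rw [Measure.addHaar_closedBall' _ _ hr, ENNReal.ofReal_mul (by positivity), hV,
        ENNReal.ofReal_toReal (isCompact_closedBall _ _).measure_lt_top.ne]
      simp
    have hlow : R ^ 2 * V ≤ ‖(memLp_testFunction (diskTest hR0)).toLp _‖ ^ 2 := by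
      rw [← ENNReal.ofReal_le_ofReal_iff (by positivity), norm_toLp_sq, ← hball R hR0.le,
        ← lintegral_indicator_one measurableSet_closedBall]
      refine lintegral_mono fun x => ?_
      by_cases hx : x ∈ Metric.closedBall (0 : Plane) R
      · rw [indicator_of_mem hx]
        change _ ≤ ENNReal.ofReal (diskCutoff R x ^ 2)
        rw [diskCutoff_eq_one hR0 (by simpa using hx)]
        simp
      · rw [indicator_of_notMem hx]
        exact zero_le
    have hup : (gagliardoENorm s (diskTest hR0)).toReal ^ 2 ≤
        D.toReal * (M ^ 2 * R ^ (-2 * (s : ℝ))) * ((2 * R) ^ 2 * V) := by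
      have h1 := hE (diskTest hR0) M R (Metric.closedBall 0 (2 * R)) (by linarith) hR0
        measurableSet_closedBall (fun x => (abs_diskCutoff_le_one R x).trans hM) (hL R hR0)
        (fun x hx => diskCutoff_eq_zero hR0 (not_le.1 (by simpa using hx)).le)
      rw [hball _ (by positivity), ← gagliardoENorm_sq] at h1
      have h2 := ENNReal.toReal_mono (ENNReal.mul_ne_top (ENNReal.mul_ne_top hD
        ENNReal.ofReal_ne_top) ENNReal.ofReal_ne_top) h1
      rwa [ENNReal.toReal_pow, ENNReal.toReal_mul, ENNReal.toReal_mul,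
        ENNReal.toReal_ofReal (by positivity), ENNReal.toReal_ofReal (by positivity)] at h2
    have h3 : R ^ 2 * V ≤ C ^ 2 *
        (D.toReal * (M ^ 2 * R ^ (-2 * (s : ℝ))) * ((2 * R) ^ 2 * V)) :=
      calc R ^ 2 * V ≤ _ := hlow
        _ ≤ (C * (gagliardoENorm s (diskTest hR0)).toReal) ^ 2 := by gcongr
        _ = C ^ 2 * (gagliardoENorm s (diskTest hR0)).toReal ^ 2 := mul_pow _ _ _
        _ ≤ _ := by gcongr
    have h4 : R ^ 2 * V * 1 ≤ R ^ 2 * V * (a * R ^ (-2 * (s : ℝ))) := by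
      rw [mul_one, ha]
      refine h3.trans (le_of_eq ?_)
      ring
    exact le_of_mul_le_mul_left h4 (by positivity)
  have hlim : Filter.Tendsto (fun R : ℝ => a * R ^ (-2 * (s : ℝ))) Filter.atTop (nhds (a * 0)) := by
    have := tendsto_rpow_neg_atTop (y := 2 * (s : ℝ)) (by have := s.2.1; linarith)
    refine Filter.Tendsto.const_mul a (this.congr fun R => ?_)
    rw [neg_mul]
  have h1 : (1 : ℝ) ≤ a * 0 := ge_of_tendsto hlim (by
    filter_upwards [Filter.eventually_ge_atTop 1] with R hR
    exact key R hR)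
  linarith

theorem corollary6p2 :
    (∀ (s : Ioo (0 : ℝ) 1) (Ω : Opens Plane), 1 / 2 < (s : ℝ) →
      IsSimplyConnected (Ω : Set Plane) → inradius (Ω : Set Plane) < ∞ →
      ∃ e : HomogeneousSobolev s Ω ≃L[ℝ] fracSobolevZero s Ω,
        ∀ u : 𝓓(Ω, ℝ), e (testToHomogeneous s u) = testToFracSobolevZero s u) ∧
    (∀ s : Ioo (0 : ℝ) 1, (s : ℝ) ≤ 1 / 2 →
      ¬ ∃ e : HomogeneousSobolev s infiniteComplementComb ≃ₗ[ℝ]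
          fracSobolevZero s infiniteComplementComb,
        (Continuous e ∨ Continuous e.symm) ∧
          ∀ u : 𝓓(infiniteComplementComb, ℝ),
            e (testToHomogeneous s u) = testToFracSobolevZero s u) := by
  refine ⟨fun s Ω hs hΩ hr => ?_, fun s hs => ?_⟩
  · obtain ⟨C, hC, h⟩ := exists_lintegral_sq_le hs hΩ hr
    refine exists_equiv_of_poincare s (C := √C.toReal) fun u =>
      norm_toLp_le_of_lintegral_le s u hC (h u u.continuous fun x hx => ?_)
    exact image_eq_zero_of_notMem_tsupport fun hx' => hx (u.tsupport_subset hx')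
  · rintro ⟨e, he, h⟩
    obtain ⟨C, hC⟩ := exists_poincare_of_equiv s e he h
    exact not_poincare_comb hs C hC
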